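/- Let $k$ be an algebraically closed field of characteristic $p=2$, let $n>1$ be an even integer, and let $G=\langle g\rangle$ be the cyclic group of order $n$. Let $V$ be the vector space with basis $a,b$, with right $kG$-action $a\cdot g=a$, $b\cdot g=a+b$ and $kG$-coaction given by the group element $g$. Let $T(V)\# kG$ be the Hopf algebra generated by $g^{\pm1},a,b$ with relations $g^n=1$, $g^{-1}ag=a$, $g^{-1}bg=a+b$ and with $$\Delta(g)=g\otimes g,\quad \Delta(a)=a\otimes 1+g\otimes a,\quad \Delta(b)=b\otimes 1+g\otimes b,\quad \varepsilon(g)=1,\quad \varepsilon(a)=\varepsilon(b)=0,$$ $$S(g)=g^{-1},\quad S(a)=-g^{-1}a,\quad S(b)=-g^{-1}b.$$ Let $\mathcal B(V)$ be the Nichols algebra of $V$ and $H=\mathcal B(V)\# kG$ its bosonization, that is, the quotient of $T(V)\# kG$ by the largest Hopf ideal contained in $\bigoplus_{m\ge 2}T^m(V)\# kG$. Then: (i) $H$ is presented, as a $k$-algebra, by the generators $g^{\pm1},a,b$ and the relations $g^n=1$, $g^{-1}ag=a$, $g^{-1}bg=a+b$, $a^2=0$, $b^4=0$, $baba=abab$,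 $b^2a=ab^2+aba$. (ii) $H$ is a symmetric Hopf algebra: it is a finite dimensional Hopf algebra, and there is a nondegenerate bilinear form $\beta:H\times H\to k$ with $\beta(xy,z)=\beta(x,yz)$ and $\beta(x,y)=\beta(y,x)$ for all $x,y,z\in H$. (iii) The element $t=\left(\sum_{i=0}^{n-1}g^i\right)abab^3$ is nonzero and is a two-sided integral, i.e. $ht=\varepsilon(h)t=th$ for all $h\in H$; and $S^2$ is an inner automorphism of $H$. -/

import Mathlib

open scoped TensorProduct

noncomputable section

namespace PointedJordan

universe u

/-! ### Symmetric algebras and integrals -/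

/-- A finite dimensional `k`-algebra `A` is symmetric if it carries a nondegenerate bilinear form
which is associative and symmetric. -/
def IsSymmetricAlgebra (k A : Type*) [Field k] [Ring A] [Algebra k A] : Prop :=
  Module.Finite k A ∧
    ∃ β : A →ₗ[k] A →ₗ[k] k, β.Nondegenerate ∧
      (∀ x y z, β (x * y) z = β x (y * z)) ∧ ∀ x y, β x y = β y x

/-- `t` is a left and a right integral of the Hopf algebra `H`. -/
def IsTwoSidedIntegral (k : Type*) {H : Type*} [Field k] [Ring H] [HopfAlgebra k H] (t : H) :
    Prop :=
  ∀ h : H, h * t = Coalgebra.counit (R := k) h • t ∧ t * h = Coalgebra.counit (R := k) h • t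

/-- The square of the antipode of `H` is an inner automorphism. -/
def AntipodeSqInner (k H : Type*) [Field k] [Ring H] [HopfAlgebra k H] : Prop :=
  ∃ u : Hˣ, ∀ x : H,
    HopfAlgebra.antipode k (HopfAlgebra.antipode k x) = (u : H) * x * ((u⁻¹ : Hˣ) : H)

/-! ### The Hopf algebra `T(V) # kG` -/

/-- Names of the generators: `g` and its inverse `gi`, which generate the cyclic group `G`, and the
basis `a = v₁`, `b = v₂` of `V`. -/
inductive Gen : Type
  | g | gi | a | b

/-- A generator as an element of the free algebra. -/
abbrev X (k : Type u) [Field k] (x : Gen) : FreeAlgebra k Gen := FreeAlgebra.ι k x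

/-- The defining relations of the smash product `T(V) # kG`: `G = ⟨g⟩` is cyclic of order `n`, and
`g⁻¹ v g = v · g` for `v ∈ V`, where `v₁ · g = v₁` and `v₂ · g = v₁ + v₂`. -/
inductive TensorRel (k : Type u) [Field k] (n : ℕ) : FreeAlgebra k Gen → FreeAlgebra k Gen → Prop
  | g_gi : TensorRel k n (X k .g * X k .gi) 1
  | gi_g : TensorRel k n (X k .gi * X k .g) 1
  | g_pow : TensorRel k n (X k .g ^ n) 1
  | conj_a : TensorRel k n (X k .gi * X k .a * X k .g) (X k .a)
  | conj_b : TensorRel k n (X k .gi * X k .b * X k .g) (X k .a + X k .b)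

/-- The algebra `T(V) # kG`. -/
def TensorBos (k : Type u) [Field k] (n : ℕ) : Type u := RingQuot (TensorRel k n)

namespace TensorBos

variable (k : Type u) [Field k] (n : ℕ)

instance instRing : Ring (TensorBos k n) := inferInstanceAs (Ring (RingQuot (TensorRel k n)))

instance instAlgebra : Algebra k (TensorBos k n) :=
  inferInstanceAs (Algebra k (RingQuot (TensorRel k n)))

/-- The quotient map from the free algebra. -/
def mk : FreeAlgebra k Gen →ₐ[k] TensorBos k n := RingQuot.mkAlgHom k (TensorRel k n)

/-- The generators of `T(V) # kG`. -/
def gen (x : Gen) : TensorBos k n := mk k n (X k x)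

variable {k n} in
lemma mk_rel {x y : FreeAlgebra k Gen} (h : TensorRel k n x y) : mk k n x = mk k n y :=
  RingQuot.mkAlgHom_rel k h

lemma g_gi : gen k n .g * gen k n .gi = 1 := by
  simpa [gen] using mk_rel (TensorRel.g_gi (k := k) (n := n))

lemma gi_g : gen k n .gi * gen k n .g = 1 := by
  simpa [gen] using mk_rel (TensorRel.gi_g (k := k) (n := n))

lemma g_pow : gen k n .g ^ n = 1 := by
  simpa [gen] using mk_rel (TensorRel.g_pow (k := k) (n := n))

lemma gi_pow : gen k n .gi ^ n = 1 := by
  have h : gen k n .gi ^ n * gen k n .g ^ n = 1 := by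
    rw [← Commute.mul_pow, gi_g, one_pow]
    exact (gi_g k n).trans (g_gi k n).symm
  simpa [g_pow] using h

lemma conj_a : gen k n .gi * gen k n .a * gen k n .g = gen k n .a := by
  simpa [gen] using mk_rel (TensorRel.conj_a (k := k) (n := n))

lemma conj_b : gen k n .gi * gen k n .b * gen k n .g = gen k n .a + gen k n .b := by
  simpa [gen] using mk_rel (TensorRel.conj_b (k := k) (n := n))

variable {k n}

/-- The algebra map out of `T(V) # kG` given by elements that satisfy the relations. -/
def lift {B : Type*} [Semiring B] [Algebra k B] (f : Gen → B)
    (h1 : f .g * f .gi = 1) (h2 : f .gi * f .g = 1) (h3 : f .g ^ n = 1)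
    (h4 : f .gi * f .a * f .g = f .a) (h5 : f .gi * f .b * f .g = f .a + f .b) :
    TensorBos k n →ₐ[k] B :=
  RingQuot.liftAlgHom k ⟨FreeAlgebra.lift k f, by
    intro x y h
    cases h <;> simp [X, h1, h2, h3, h4, h5]⟩

@[simp] lemma lift_gen {B : Type*} [Semiring B] [Algebra k B] (f : Gen → B)
    (h1 : f .g * f .gi = 1) (h2 : f .gi * f .g = 1) (h3 : f .g ^ n = 1)
    (h4 : f .gi * f .a * f .g = f .a) (h5 : f .gi * f .b * f .g = f .a + f .b) (x : Gen) :
    lift f h1 h2 h3 h4 h5 (gen k n x) = f x := by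
  have := RingQuot.liftAlgHom_mkAlgHom_apply k (FreeAlgebra.lift k f) (s := TensorRel k n)
    (by intro x y h; cases h <;> simp [X, h1, h2, h3, h4, h5]) (X k x)
  exact this.trans (FreeAlgebra.lift_ι_apply ..)

lemma algHom_ext {B : Type*} [Semiring B] [Algebra k B] {φ ψ : TensorBos k n →ₐ[k] B}
    (h : ∀ x, φ (gen k n x) = ψ (gen k n x)) : φ = ψ := by
  apply RingQuot.ringQuot_ext'
  apply FreeAlgebra.hom_ext
  funext x
  exact h x

lemma induction {P : TensorBos k n → Prop} (hs : ∀ r : k, P (algebraMap k _ r))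
    (hg : ∀ x, P (gen k n x)) (ha : ∀ x y, P x → P y → P (x + y))
    (hm : ∀ x y, P x → P y → P (x * y)) (x : TensorBos k n) : P x := by
  obtain ⟨y, rfl⟩ : ∃ y, mk k n y = x := RingQuot.mkAlgHom_surjective k (TensorRel k n) x
  induction y using FreeAlgebra.induction with
  | grade0 r => simpa using hs r
  | grade1 x => exact hg x
  | mul x y hx hy => simpa using hm _ _ hx hy
  | add x y hx hy => simpa using ha _ _ hx hy

variable (k n)

/-- Values of the comultiplication on the generators: `g` and `gi` are group-like,
`Δ(a) = a ⊗ 1 + g ⊗ a` and `Δ(b) = b ⊗ 1 + g ⊗ b`. -/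
def comulGen : Gen → TensorBos k n ⊗[k] TensorBos k n
  | .g => gen k n .g ⊗ₜ gen k n .g
  | .gi => gen k n .gi ⊗ₜ gen k n .gi
  | .a => gen k n .a ⊗ₜ 1 + gen k n .g ⊗ₜ gen k n .a
  | .b => gen k n .b ⊗ₜ 1 + gen k n .g ⊗ₜ gen k n .b

/-- The comultiplication of `T(V) # kG`. -/
def comulHom : TensorBos k n →ₐ[k] TensorBos k n ⊗[k] TensorBos k n :=
  lift (comulGen k n)
    (by simp [comulGen, g_gi, Algebra.TensorProduct.one_def])
    (by simp [comulGen, gi_g, Algebra.TensorProduct.one_def])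
    (by simp [comulGen, g_pow, Algebra.TensorProduct.one_def])
    (by simp [comulGen, mul_add, add_mul, conj_a, gi_g])
    (by
      simp [comulGen, mul_add, add_mul, conj_b, gi_g, TensorProduct.add_tmul,
        TensorProduct.tmul_add]
      abel)

/-- Values of the counit on the generators. -/
def counitGen : Gen → k
  | .g => 1
  | .gi => 1
  | .a => 0
  | .b => 0

/-- The counit of `T(V) # kG`. -/
def counitHom : TensorBos k n →ₐ[k] k :=
  lift (counitGen k) (by simp [counitGen]) (by simp [counitGen]) (by simp [counitGen])
    (by simp [counitGen]) (by simp [counitGen])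

/-- Values of the antipode on the generators: `S(g) = g⁻¹`, `S(a) = -g⁻¹a`, `S(b) = -g⁻¹b`. -/
def antipodeGen : Gen → TensorBos k n
  | .g => gen k n .gi
  | .gi => gen k n .g
  | .a => -(gen k n .gi * gen k n .a)
  | .b => -(gen k n .gi * gen k n .b)

/-- The antipode of `T(V) # kG`, as an algebra map to the opposite algebra. -/
def antipodeHom : TensorBos k n →ₐ[k] (TensorBos k n)ᵐᵒᵖ :=
  lift (fun x ↦ MulOpposite.op (antipodeGen k n x))
    (by simp [antipodeGen, ← MulOpposite.op_mul, g_gi])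
    (by simp [antipodeGen, ← MulOpposite.op_mul, gi_g])
    (by simp [antipodeGen, ← MulOpposite.op_pow, gi_pow])
    (by
      simp only [antipodeGen, ← MulOpposite.op_mul]
      congr 1
      calc gen k n .gi * (-(gen k n .gi * gen k n .a) * gen k n .g)
          = -(gen k n .gi * (gen k n .gi * gen k n .a * gen k n .g)) := by
            simp only [neg_mul, mul_neg, mul_assoc]
        _ = _ := by rw [conj_a])
    (by
      simp only [antipodeGen, ← MulOpposite.op_mul, ← MulOpposite.op_add]
      congr 1
      calc gen k n .gi * (-(gen k n .gi * gen k n .b) * gen k n .g)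
          = -(gen k n .gi * (gen k n .gi * gen k n .b * gen k n .g)) := by
            simp only [neg_mul, mul_neg, mul_assoc]
        _ = _ := by rw [conj_b, mul_add, neg_add])

@[simp] lemma comulHom_gen (x : Gen) : comulHom k n (gen k n x) = comulGen k n x :=
  lift_gen ..

@[simp] lemma counitHom_gen (x : Gen) : counitHom k n (gen k n x) = counitGen k x :=
  lift_gen ..

@[simp] lemma antipodeHom_gen (x : Gen) :
    antipodeHom k n (gen k n x) = MulOpposite.op (antipodeGen k n x) := by
  simp [antipodeHom]

/-- The bialgebra structure of `T(V) # kG`. -/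
instance instBialgebra : Bialgebra k (TensorBos k n) :=
  .ofAlgHom (comulHom k n) (counitHom k n)
    (algHom_ext fun x ↦ by
      cases x <;>
        simp [comulGen, TensorProduct.add_tmul, TensorProduct.tmul_add,
          Algebra.TensorProduct.one_def, add_assoc])
    (algHom_ext fun x ↦ by cases x <;> simp [comulGen, counitGen])
    (algHom_ext fun x ↦ by cases x <;> simp [comulGen, counitGen])

/-- The antipode of `T(V) # kG`. -/
def antipodeMap : TensorBos k n →ₗ[k] TensorBos k n :=
  (MulOpposite.opLinearEquiv k).symm.toLinearMap ∘ₗ (antipodeHom k n).toLinearMap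

@[simp] lemma antipodeMap_one : antipodeMap k n 1 = 1 := by
  simp [antipodeMap]

lemma antipodeMap_mul (x y : TensorBos k n) :
    antipodeMap k n (x * y) = antipodeMap k n y * antipodeMap k n x := by
  simp [antipodeMap]

@[simp] lemma antipodeMap_gen (x : Gen) :
    antipodeMap k n (gen k n x) = antipodeGen k n x := by
  simp [antipodeMap]

@[simp] lemma antipodeMap_algebraMap (r : k) :
    antipodeMap k n (algebraMap k _ r) = algebraMap k _ r := by
  simp [antipodeMap]

lemma antipode_left (x : TensorBos k n) :
    LinearMap.mul' k _ ((antipodeMap k n).rTensor _ (comulHom k n x)) =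
      algebraMap k _ (counitHom k n x) := by
  induction x using induction with
  | hs r => simp [Algebra.TensorProduct.algebraMap_apply]
  | hg x =>
    cases x <;> simp [comulGen, counitGen, antipodeGen, g_gi, gi_g]
  | ha x y hx hy => simp only [map_add, hx, hy]
  | hm x y hx hy =>
    have key : ∀ z w : TensorBos k n ⊗[k] TensorBos k n, ∀ r : k,
        LinearMap.mul' k _ ((antipodeMap k n).rTensor _ z) = algebraMap k _ r →
        LinearMap.mul' k _ ((antipodeMap k n).rTensor _ (z * w)) =
          r • LinearMap.mul' k _ ((antipodeMap k n).rTensor _ w) := by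
      intro z w r hz
      have step : ∀ p q : TensorBos k n,
          LinearMap.mul' k _ ((antipodeMap k n).rTensor _ (z * p ⊗ₜ q)) =
            antipodeMap k n p * LinearMap.mul' k _ ((antipodeMap k n).rTensor _ z) * q := by
        intro p q
        clear hz
        induction z with
        | zero => simp
        | tmul u v => simp [antipodeMap_mul, mul_assoc]
        | add u v hu hv => simp only [add_mul, map_add, hu, hv, mul_add]
      induction w with
      | zero => simp
      | tmul p q => rw [step, hz]; simp [Algebra.algebraMap_eq_smul_one]
      | add u v hu hv => rw [mul_add, map_add, map_add, hu, hv, map_add, map_add, smul_add]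
    rw [map_mul, key _ _ _ hx, hy, map_mul, map_mul, Algebra.smul_def]

lemma antipode_right (x : TensorBos k n) :
    LinearMap.mul' k _ ((antipodeMap k n).lTensor _ (comulHom k n x)) =
      algebraMap k _ (counitHom k n x) := by
  induction x using induction with
  | hs r => simp [Algebra.TensorProduct.algebraMap_apply]
  | hg x =>
    cases x <;> simp [comulGen, counitGen, antipodeGen, g_gi, gi_g, ← mul_assoc]
  | ha x y hx hy => simp only [map_add, hx, hy]
  | hm x y hx hy =>
    have key : ∀ z w : TensorBos k n ⊗[k] TensorBos k n, ∀ r : k,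
        LinearMap.mul' k _ ((antipodeMap k n).lTensor _ w) = algebraMap k _ r →
        LinearMap.mul' k _ ((antipodeMap k n).lTensor _ (z * w)) =
          r • LinearMap.mul' k _ ((antipodeMap k n).lTensor _ z) := by
      intro z w r hw
      have step : ∀ p q : TensorBos k n,
          LinearMap.mul' k _ ((antipodeMap k n).lTensor _ (p ⊗ₜ q * w)) =
            p * LinearMap.mul' k _ ((antipodeMap k n).lTensor _ w) * antipodeMap k n q := by
        intro p q
        clear hw
        induction w with
        | zero => simp
        | tmul u v => simp [antipodeMap_mul, mul_assoc]
        | add u v hu hv => simp only [mul_add, map_add, hu, hv, add_mul]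
      induction z with
      | zero => simp
      | tmul p q => rw [step, hw]; simp [Algebra.algebraMap_eq_smul_one]
      | add u v hu hv => rw [add_mul, map_add, map_add, hu, hv, map_add, map_add, smul_add]
    rw [map_mul, key _ _ _ hy, hx, map_mul, map_mul, Algebra.smul_def, Algebra.commutes]

/-- The Hopf algebra structure of `T(V) # kG`. -/
instance instHopfAlgebra : HopfAlgebra k (TensorBos k n) where
  antipode := antipodeMap k n
  mul_antipode_rTensor_comul := LinearMap.ext (antipode_left k n)
  mul_antipode_lTensor_comul := LinearMap.ext (antipode_right k n)

/-- The part of `T(V) # kG` of tensor degree at least two, `⨁_{m ≥ 2} T^m(V) # kG`. -/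
def degGeTwo : Submodule k (TensorBos k n) :=
  Submodule.span k {w | ∃ x y z : TensorBos k n, ∃ u ∈ ({.a, .b} : Set Gen),
    ∃ v ∈ ({.a, .b} : Set Gen), w = x * gen k n u * y * gen k n v * z}

/-- The two-sided Hopf ideals of `T(V) # kG` that are contained in tensor degrees at least two. -/
def hopfIdealsGeTwo : Set (Ideal (TensorBos k n)) :=
  {J | J.IsTwoSided ∧ J.IsHopfIdeal k ∧ ∀ x ∈ J, x ∈ degGeTwo k n}

/-- The ideal of relations of the Nichols algebra, bosonized: the largest Hopf ideal of `T(V) # kG`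
contained in tensor degrees at least two. It equals `I(V) # kG`, where `B(V) = T(V) / I(V)`. -/
def nicholsIdeal : Ideal (TensorBos k n) := sSup (hopfIdealsGeTwo k n)

variable {k n}

lemma nicholsIdeal_induction {P : TensorBos k n → Prop} (h0 : P 0)
    (ha : ∀ x y, P x → P y → P (x + y))
    (hm : ∀ J ∈ hopfIdealsGeTwo k n, J ≤ nicholsIdeal k n → ∀ x ∈ J, P x)
    {x : TensorBos k n} (hx : x ∈ nicholsIdeal k n) : P x := by
  rw [nicholsIdeal, sSup_eq_iSup'] at hx
  exact Submodule.iSup_induction (motive := P) _ hx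
    (fun J y hy ↦ hm J.1 J.2 (le_sSup J.2) y hy) h0 ha

variable (k n)

instance nicholsIdeal_isTwoSided : (nicholsIdeal k n).IsTwoSided where
  mul_mem_of_left {a} b h := by
    refine nicholsIdeal_induction (P := fun x ↦ x * b ∈ nicholsIdeal k n) (by simp)
      (fun x y hx hy ↦ by simpa [add_mul] using add_mem hx hy) (fun J hJ hle x hx ↦ ?_) h
    have := hJ.1
    exact hle (J.mul_mem_right b hx)

instance nicholsIdeal_isHopfIdeal : (nicholsIdeal k n).IsHopfIdeal k where
  counit_eq_zero x hx := by
    refine nicholsIdeal_induction (P := fun x ↦ Coalgebra.counit (R := k) x = 0) (by simp)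
      (fun x y hx hy ↦ by simp only [map_add, hx, hy, add_zero]) (fun J hJ hle x hx ↦ ?_) hx
    exact hJ.2.1.counit_eq_zero hx
  map_mkQ_comul_eq_zero x hx := by
    refine nicholsIdeal_induction
      (P := fun x ↦ TensorProduct.map ((nicholsIdeal k n).restrictScalars k).mkQ
        ((nicholsIdeal k n).restrictScalars k).mkQ (Coalgebra.comul x) = 0) (by simp)
      (fun x y hx hy ↦ by simp only [map_add, hx, hy, add_zero]) (fun J hJ hle x hx ↦ ?_) hx
    have h : J.restrictScalars k ≤ (nicholsIdeal k n).restrictScalars k := hle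
    have h2 := hJ.2.1.map_mkQ_comul_eq_zero hx
    rw [← Submodule.factor_comp_mk h, TensorProduct.map_comp, LinearMap.comp_apply, h2, map_zero]
  antipode_mem x hx := by
    refine nicholsIdeal_induction
      (P := fun x ↦ HopfAlgebra.antipode k x ∈ nicholsIdeal k n) (by simp)
      (fun x y hx hy ↦ by simpa only [map_add] using add_mem hx hy)
      (fun J hJ hle x hx ↦ ?_) hx
    exact hle (hJ.2.1.antipode_mem hx)

/-- The supremum is attained: `nicholsIdeal` is the largest element of `hopfIdealsGeTwo`. -/
lemma isGreatest_nicholsIdeal : IsGreatest (hopfIdealsGeTwo k n) (nicholsIdeal k n) :=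
  ⟨⟨inferInstance, inferInstance, fun _ hx ↦
    nicholsIdeal_induction (P := fun x ↦ x ∈ degGeTwo k n) (zero_mem _)
      (fun _ _ ↦ add_mem) (fun _ hJ _ x hx ↦ hJ.2.2 x hx) hx⟩, fun _ hJ ↦ le_sSup hJ⟩

end TensorBos

/-- The Hopf algebra `B(V) # kG`. -/
abbrev NicholsBos (k : Type u) [Field k] (n : ℕ) : Type u :=
  TensorBos k n ⧸ TensorBos.nicholsIdeal k n

namespace NicholsBos

variable (k : Type u) [Field k] (n : ℕ)

/-- The generators of `B(V) # kG`. -/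
def gen (x : Gen) : NicholsBos k n :=
  Ideal.Quotient.mk (TensorBos.nicholsIdeal k n) (TensorBos.gen k n x)

/-- The relations of `B(V) # kG` in characteristic two: those of `T(V) # kG` together with `a² = 0`,
`b⁴ = 0`, `baba = abab` and `b²a = ab² + aba`. -/
inductive Rel : FreeAlgebra k Gen → FreeAlgebra k Gen → Prop
  | tensor (x y : FreeAlgebra k Gen) (h : TensorRel k n x y) : Rel x y
  | a_sq : Rel (X k .a ^ 2) 0
  | b_pow : Rel (X k .b ^ 4) 0
  | baba : Rel (X k .b * X k .a * X k .b * X k .a) (X k .a * X k .b * X k .a * X k .b)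
  | bba : Rel (X k .b ^ 2 * X k .a) (X k .a * X k .b ^ 2 + X k .a * X k .b * X k .a)

/-- The element `(∑_{0 ≤ i < n} g^i) a b a b³` of `B(V) # kG`. -/
def t : NicholsBos k n :=
  (∑ i ∈ Finset.range n, gen k n .g ^ i) *
    (gen k n .a * gen k n .b * gen k n .a * gen k n .b ^ 3)

end NicholsBos
end PointedJordan
end

open scoped TensorProduct

noncomputable section

namespace PointedJordan

set_option linter.unusedSimpArgs false

/-! Put `u = ab + ba`. In characteristic 2 the relations in (i) say that `g, a, u` generate a
commutative algebra `E` with `gⁿ = 1`, `a² = u² = 0`, and that the commutator with `b` is the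
derivation `δ` of `E` with `δ a = u`, `δ u = a u`, `δ g = g a`. So the presented algebra `Pres` is
`E[b; δ] / (b⁴)`. It is free as a right `E`-module on `1, b, b², b³`: these span because their span
contains `1` and is stable under right multiplication (`exists_ofCoords_mul`), and they are
independent because left multiplication on the expected basis does define a matrix representation
over `E` (`modelGen_rel`). Evenness of `n` makes `δ` well defined, since `δ (gⁿ) = n gⁿ a` has to
vanish.

Presentation: the kernel of `T(V) # kG → Pres` is a Hopf ideal in degrees at least two
(`relIdeal_mem_hopfIdealsGeTwo`), so it lies in the Nichols ideal. Conversely, suppose `x` is in the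
Nichols ideal but nonzero in `Pres`. Multiplying on both sides moves it to `b³ a u c` with `0 ≠ c ∈
kG` (`exists_mul_mul_eq`). Skew derivations preserve the Nichols ideal and strip off `b³ a u`
(`ofGrp_mem_of_top_mem`), so `c` itself is in the Nichols ideal, which is absurd because `kG` meets
degrees at least two only in zero.

Symmetry: the form is `(x, y) ↦ τ(xy)`, where `τ` is the coefficient of `b³ a u g`. The factor `g`
is essential: `δ (gⁱ u) = (i + 1) gⁱ a u` vanishes for `i = 1` but not for `i = 0`, so `τ` kills
commutators with `b`. Nondegeneracy is again `exists_mul_mul_eq`.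

Integral: `aba = a u`, hence `t = (∑ gⁱ) a u b³`, and the integral property is a computation with
`δ`. Finally, `S²` is conjugation by `g⁻¹` already on `T(V) # kG`. -/

lemma mul_mul_of_eq {S : Type*} [Semigroup S] {x y z : S} (h : x * y = z) (w : S) :
    x * (y * w) = z * w := by
  rw [← mul_assoc, h]

/-! ### Differential operator relations and their stability under the Hopf operations -/

/-- The relations of the differential operator ring `E[b; δ]` with `b ^ 4 = 0` in characteristic
two, where `E` is generated by the commuting elements `g`, `a`, `u` with `a² = u² = 0` and
`δ a = u`, `δ u = a u`, `δ g = g a`. -/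
structure OreRel {S : Type*} [Ring S] (g a u b : S) : Prop where
  add_self (x : S) : x + x = 0
  a_g : a * g = g * a
  u_g : u * g = g * u
  u_a : u * a = a * u
  a_a : a * a = 0
  u_u : u * u = 0
  b_g : b * g = g * b + g * a
  b_a : b * a = a * b + u
  b_u : b * u = u * b + a * u
  b_b : b * (b * (b * b)) = 0

namespace OreRel

variable {S : Type*} [Ring S] {g a u b g' a' u' b' : S}

lemma add_add_self (h : OreRel g a u b) (x y : S) : x + (x + y) = y := by
  rw [← add_assoc, h.add_self, zero_add]

/-- This is the reason that `Δ` respects the relations: the two quadruples play the roles of `x ⊗ 1`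
and `1 ⊗ x`. The third entry is the anticommutator of `a + g a'` and `b + g b'`; its mixed term `g a
a'` comes from `b g = g b + g a`. -/
lemma tensor (h : OreRel g a u b) (h' : OreRel g' a' u' b')
    (hc : ∀ x ∈ ({g', a', u', b'} : Set S), ∀ y ∈ ({g, a, u, b} : Set S), x * y = y * x) :
    OreRel (g * g') (a + g * a') (u + g * (a * a') + g * (g * u')) (b + g * b') := by
  simp only [Set.mem_insert_iff, Set.mem_singleton_iff, forall_eq_or_imp, forall_eq] at hc
  obtain ⟨⟨c1, c2, c3, c4⟩, ⟨c5, c6, c7, c8⟩, ⟨c9, c10, c11, c12⟩, ⟨c13, c14, c15, c16⟩⟩ := hc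
  -- The fourth power is computed as the square of the square, where the doubled terms have already
  -- cancelled.
  have hsq : (b + g * b') * (b + g * b') = b * b + g * (a * b') + g * (g * (b' * b')) := by
    simp only [mul_assoc, add_mul, mul_add, c4, c16, h.b_g, mul_mul_of_eq c13, mul_mul_of_eq h.b_g]
    simp only [add_assoc, add_left_comm, add_comm, h.add_self, h.add_add_self, add_zero]
  constructor
  case add_self => exact h.add_self
  on_goal 9 => rw [← mul_assoc, hsq]
  all_goals
    simp only [mul_assoc, add_mul, mul_add, c1, c2, c3, c4, c5, c6, c7, c8, c9, c10, c11, c12, c13,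
      c14, c15, c16, mul_mul_of_eq c1, mul_mul_of_eq c2, mul_mul_of_eq c3, mul_mul_of_eq c4,
      mul_mul_of_eq c5, mul_mul_of_eq c6, mul_mul_of_eq c7, mul_mul_of_eq c8,
      mul_mul_of_eq c9, mul_mul_of_eq c10, mul_mul_of_eq c11, mul_mul_of_eq c12,
      mul_mul_of_eq c13, mul_mul_of_eq c14, mul_mul_of_eq c15, mul_mul_of_eq c16,
      h.a_g, h.u_g, h.u_a, h.a_a, h.u_u, h.b_g, h.b_a, h.b_u, h.b_b,
      mul_mul_of_eq h.a_g, mul_mul_of_eq h.u_g, mul_mul_of_eq h.u_a, mul_mul_of_eq h.a_a,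
      mul_mul_of_eq h.u_u, mul_mul_of_eq h.b_g, mul_mul_of_eq h.b_a, mul_mul_of_eq h.b_u,
      mul_mul_of_eq h.b_b,
      h'.a_g, h'.u_g, h'.u_a, h'.a_a, h'.u_u, h'.b_g, h'.b_a, h'.b_u, h'.b_b,
      mul_mul_of_eq h'.a_g, mul_mul_of_eq h'.u_g, mul_mul_of_eq h'.u_a, mul_mul_of_eq h'.a_a,
      mul_mul_of_eq h'.u_u, mul_mul_of_eq h'.b_g, mul_mul_of_eq h'.b_a, mul_mul_of_eq h'.b_u,
      mul_mul_of_eq h'.b_b, zero_mul, mul_zero, add_zero, zero_add]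
    try simp only [add_assoc, add_left_comm, add_comm, h.add_self, h.add_add_self, add_zero,
      zero_add]

/-- The relations satisfied by the images of the generators under the antipode, in the opposite
algebra. -/
lemma antipode {gi : S} (h : OreRel g a u b) (h1 : g * gi = 1) (h2 : gi * g = 1) :
    OreRel (MulOpposite.op gi) (MulOpposite.op (gi * a)) (MulOpposite.op (gi * (gi * u)))
      (MulOpposite.op (gi * b)) := by
  -- Moving `g` past an element in one direction is the same as moving `g⁻¹` past it in the other.
  -- The signs of the antipode disappear in characteristic 2.
  have swap : ∀ x y : S, x * g = g * y → y * gi = gi * x := fun x y e ↦ by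
    calc y * gi = gi * (g * y) * gi := by rw [← mul_assoc, h2, one_mul]
      _ = gi * x * (g * gi) := by rw [← e]; simp only [mul_assoc]
      _ = gi * x := by rw [h1, mul_one]
  have ha := swap _ _ h.a_g
  have hu := swap _ _ h.u_g
  have hb : b * gi = gi * b + gi * a := by
    have := swap b (b + a) (by rw [h.b_g, mul_add])
    rw [add_mul, ha] at this
    rw [← this, add_assoc, h.add_self, add_zero]
  have hsq : gi * b * (gi * b) = gi * (gi * (b * b)) + gi * (gi * (a * b)) := by
    simp only [mul_assoc, add_mul, mul_add, mul_mul_of_eq hb]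
  constructor
  case add_self => exact fun x ↦ MulOpposite.unop_injective (h.add_self _)
  on_goal 9 => rw [← mul_assoc, ← MulOpposite.op_mul, hsq]
  all_goals
    apply MulOpposite.unop_injective
    simp only [MulOpposite.unop_mul, MulOpposite.unop_add, MulOpposite.unop_op,
      MulOpposite.unop_zero, mul_assoc, add_mul, mul_add, ha, hb, hu,
      h.a_g, h.u_g, h.u_a, h.a_a, h.u_u, h.b_g, h.b_a, h.b_u, h.b_b,
      mul_mul_of_eq ha, mul_mul_of_eq hb, mul_mul_of_eq hu,
      mul_mul_of_eq h.a_g, mul_mul_of_eq h.u_g, mul_mul_of_eq h.u_a, mul_mul_of_eq h.a_a,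
      mul_mul_of_eq h.u_u, mul_mul_of_eq h.b_g, mul_mul_of_eq h.b_a, mul_mul_of_eq h.b_u,
      mul_mul_of_eq h.b_b, zero_mul, mul_zero, add_zero, zero_add]
    try simp only [add_assoc, add_left_comm, add_comm, h.add_self, h.add_add_self, add_zero,
      zero_add]

end OreRel

/-! ### The given relations in terms of the commutator `u` -/

/-- Elements of a ring of characteristic two that satisfy the defining relations of `B(V) # kG`. -/
structure NicholsRel (n : ℕ) {S : Type*} [Ring S] (f : Gen → S) : Prop where
  add_self (x : S) : x + x = 0
  g_gi : f .g * f .gi = 1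
  gi_g : f .gi * f .g = 1
  g_pow : f .g ^ n = 1
  conj_a : f .gi * f .a * f .g = f .a
  conj_b : f .gi * f .b * f .g = f .a + f .b
  a_sq : f .a ^ 2 = 0
  b_pow : f .b ^ 4 = 0
  baba : f .b * f .a * f .b * f .a = f .a * f .b * f .a * f .b
  bba : f .b ^ 2 * f .a = f .a * f .b ^ 2 + f .a * f .b * f .a

/-- The commutator of the two generators of `V`. -/
def comm {S : Type*} [Ring S] (f : Gen → S) : S := f .a * f .b + f .b * f .a

namespace NicholsRel

variable {n : ℕ} {S : Type*} [Ring S] {f : Gen → S}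

lemma g_mul_conj (h : NicholsRel n f) (x : S) : f .g * (f .gi * x * f .g) = x * f .g := by
  rw [← mul_assoc, ← mul_assoc, h.g_gi, one_mul]

/-- Given `a² = 0`, the relation `b²a = ab² + aba` amounts to `δ u = a u`, and `baba = abab` then
yields `u² = 0`, as `ab²a = 0`. -/
lemma oreRel (h : NicholsRel n f) : OreRel (f .g) (f .a) (comm f) (f .b) := by
  have add_add_self (x y : S) : x + (x + y) = y := by rw [← add_assoc, h.add_self, zero_add]
  have aa : f .a * f .a = 0 := by rw [← sq, h.a_sq]
  have ag : f .a * f .g = f .g * f .a := by rw [← h.g_mul_conj, h.conj_a]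
  have bg : f .b * f .g = f .g * f .b + f .g * f .a := by
    rw [← h.g_mul_conj, h.conj_b, mul_add, add_comm]
  have bba : f .b * (f .b * f .a) = f .a * (f .b * f .b) + f .a * (f .b * f .a) := by
    simpa only [sq, mul_assoc] using h.bba
  have baba : f .b * (f .a * (f .b * f .a)) = f .a * (f .b * (f .a * f .b)) := by
    simpa only [mul_assoc] using h.baba
  have b4 : f .b * (f .b * (f .b * f .b)) = 0 := by
    simpa only [pow_succ, pow_zero, one_mul, mul_assoc] using h.b_pow
  constructor
  · exact h.add_self
  all_goals
    simp only [comm, mul_assoc, add_mul, mul_add, aa, ag, bg, bba, baba, b4, mul_mul_of_eq aa,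
      mul_mul_of_eq ag, mul_mul_of_eq bg, zero_mul, mul_zero, add_zero, zero_add]
    try simp only [add_assoc, add_left_comm, add_comm, h.add_self, add_add_self, add_zero,
      zero_add]

/-- The converse translation, used to check relations in a concrete ring; `b_a` forces `u` to be the
commutator, so any convenient expression for it may be supplied. -/
lemma of_oreRel {u : S} (h1 : f .g * f .gi = 1) (h2 : f .gi * f .g = 1) (h3 : f .g ^ n = 1)
    (h : OreRel (f .g) (f .a) u (f .b)) : NicholsRel n f := by
  constructor
  · exact h.add_self
  · exact h1
  · exact h2
  · exact h3
  · rw [mul_assoc, h.a_g, ← mul_assoc, h2, one_mul]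
  · rw [mul_assoc, h.b_g, mul_add, ← mul_assoc, ← mul_assoc, h2, one_mul, one_mul, add_comm]
  all_goals
    simp only [pow_succ, pow_zero, one_mul, mul_assoc, add_mul, mul_add,
      h.u_a, h.a_a, h.u_u, h.b_a, h.b_u, h.b_b,
      mul_mul_of_eq h.u_a, mul_mul_of_eq h.a_a,
      mul_mul_of_eq h.u_u, mul_mul_of_eq h.b_a, mul_mul_of_eq h.b_u,
      mul_mul_of_eq h.b_b, zero_mul, mul_zero, add_zero, zero_add]
    try simp only [add_assoc, add_left_comm, add_comm, h.add_self, h.add_add_self, add_zero,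
      zero_add]

lemma map (h : NicholsRel n f) {T : Type*} [Ring T] (φ : S →+* T)
    (hT : ∀ x : T, x + x = 0) : NicholsRel n (fun x ↦ φ (f x)) where
  add_self := hT
  g_gi := by rw [← map_mul, h.g_gi, map_one]
  gi_g := by rw [← map_mul, h.gi_g, map_one]
  g_pow := by rw [← map_pow, h.g_pow, map_one]
  conj_a := by rw [← map_mul, ← map_mul, h.conj_a]
  conj_b := by rw [← map_mul, ← map_mul, h.conj_b, map_add]
  a_sq := by rw [← map_pow, h.a_sq, map_zero]
  b_pow := by rw [← map_pow, h.b_pow, map_zero]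
  baba := by simp only [← map_mul, h.baba]
  bba := by simp only [← map_mul, ← map_pow, ← map_add, h.bba]

end NicholsRel
-- The Leibniz rule for `δ` on `x + y a + z u + w a u`, where `δ x = a x'` and likewise for the
-- other coefficients. The contributions of `w`, and those of `y'`, vanish by `a² = u² = 0`.
lemma OreRel.coef_mul_b {S : Type*} [Ring S] {g a u b : S} (h : OreRel g a u b)
    {x y z w x' y' z' w' : S} (ax' : a * x' = x' * a) (ay' : a * y' = y' * a)
    (az' : a * z' = z' * a) (aw' : a * w' = w' * a)
    (hx : x * b = b * x + a * x') (hy : y * b = b * y + a * y') (hz : z * b = b * z + a * z')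
    (hw : w * b = b * w + a * w') :
    (x + y * a + (z + w * a) * u) * b =
      b * (x + y * a + (z + w * a) * u) + (x' * a + (y + (z + z') * a) * u) := by
  have ab : a * b = b * a + u := by rw [h.b_a, add_assoc, h.add_self, add_zero]
  have ub : u * b = b * u + a * u := by rw [h.b_u, add_assoc, h.add_self, add_zero]
  have e2 : y * a * b = b * (y * a) + y * u := by
    rw [mul_assoc, ab, mul_add, ← mul_assoc, hy, ay', add_mul, mul_assoc, mul_assoc, h.a_a,
      mul_zero, add_zero]
  have e3 : z * u * b = b * (z * u) + z' * a * u + z * a * u := by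
    rw [mul_assoc, ub, mul_add, ← mul_assoc, hz, az', add_mul, mul_assoc, mul_assoc z]
  have e4 : w * a * u * b = b * (w * a * u) := by
    rw [mul_assoc, ub, mul_add, ← mul_assoc (w * a), ← mul_assoc (w * a), mul_assoc w a b,
      mul_assoc w a a, h.a_a, mul_zero, zero_mul, add_zero, ab, mul_add, add_mul, mul_assoc w u,
      h.u_u, mul_zero, add_zero, ← mul_assoc w, hw, aw', add_mul, mul_assoc w', h.a_a, mul_zero,
      add_zero]
    simp only [mul_assoc]
  simp only [add_mul, mul_add] at *
  rw [hx, e2, e3, e4, ax']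
  abel

/-! ### The coefficient ring -/

section Coefficients

variable (k : Type*) [Field k] (n : ℕ)

/-- The group algebra of the cyclic group of order `n`. -/
abbrev GrpAlg : Type _ := MonoidAlgebra k (Multiplicative (ZMod n))

/-- The generator of the cyclic group in its group algebra. -/
def grpGen : GrpAlg k n := MonoidAlgebra.single (Multiplicative.ofAdd 1) 1

variable {k n}

lemma grpGen_pow (i : ℕ) :
    grpGen k n ^ i = MonoidAlgebra.single (Multiplicative.ofAdd (i : ZMod n)) 1 := by
  rw [grpGen, MonoidAlgebra.single_pow, one_pow, ← ofAdd_nsmul, nsmul_one]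

lemma grpGen_pow_card : grpGen k n ^ n = 1 := by
  rw [grpGen_pow, ZMod.natCast_self]; rfl

lemma grpAlg_induction [NeZero n] {P : GrpAlg k n → Prop} (pow : ∀ i, P (grpGen k n ^ i))
    (add : ∀ x y, P x → P y → P (x + y)) (smul : ∀ (r : k) x, P x → P (r • x))
    (x : GrpAlg k n) : P x := by
  refine MonoidAlgebra.induction_on x (fun m ↦ ?_) add smul
  have := pow m.toAdd.val
  rwa [grpGen_pow, ZMod.natCast_zmod_val] at this

/-- The algebra map out of the group algebra of the cyclic group of order `n` given by a unit
whose `n`-th power is one. -/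
def grpLift {S : Type*} [Ring S] [Algebra k S] (x y : S) (h1 : x * y = 1) (h2 : y * x = 1)
    (h3 : x ^ n = 1) : GrpAlg k n →ₐ[k] S :=
  MonoidAlgebra.lift k S _ ((Units.coeHom S).comp (AddMonoidHom.toMultiplicativeLeft
    (ZMod.lift n ⟨zmultiplesHom (Additive Sˣ) (Additive.ofMul ⟨x, y, h1, h2⟩), by
      rw [zmultiplesHom_apply, natCast_zsmul, ← ofMul_pow]
      exact congrArg Additive.ofMul (Units.ext (by simpa using h3))⟩)))

@[simp] lemma grpLift_grpGen {S : Type*} [Ring S] [Algebra k S] (x y : S) (h1 : x * y = 1)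
    (h2 : y * x = 1) (h3 : x ^ n = 1) : grpLift x y h1 h2 h3 (grpGen k n) = x := by
  have : (1 : ZMod n) = ((1 : ℤ) : ZMod n) := by simp
  simp only [grpLift, grpGen, MonoidAlgebra.lift_single, one_smul, MonoidHom.comp_apply]
  rw [AddMonoidHom.toMultiplicativeLeft_apply_apply, toAdd_ofAdd, this, ZMod.lift_coe]
  simp

variable (k n)

/-- A dual number from its two coefficients. -/
def dualMk {R : Type*} (x y : R) : DualNumber R := (x, y)

lemma dualMk_eq_add {R : Type*} [CommRing R] (x y : R) :
    dualMk x y = TrivSqZeroExt.inl x + TrivSqZeroExt.inl y * DualNumber.eps := by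
  refine TrivSqZeroExt.ext (?_ : x = _) (?_ : y = _) <;> simp

/-- The commutative algebra generated by `g`, `a`, `u` with `g ^ n = 1`, `a² = u² = 0`. -/
def Coef : Type _ := DualNumber (DualNumber (GrpAlg k n))

namespace Coef

instance instCommRing : CommRing (Coef k n) :=
  inferInstanceAs (CommRing (DualNumber (DualNumber (GrpAlg k n))))

instance instAlgebra : Algebra k (Coef k n) :=
  inferInstanceAs (Algebra k (DualNumber (DualNumber (GrpAlg k n))))

instance instFinite [NeZero n] : Module.Finite k (Coef k n) := by
  have h1 : Module.Finite k (GrpAlg k n) :=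
    Module.Finite.equiv (MonoidAlgebra.coeffLinearEquiv k).symm
  have h2 : Module.Finite k (GrpAlg k n × GrpAlg k n) := inferInstance
  exact (inferInstance :
    Module.Finite k ((GrpAlg k n × GrpAlg k n) × (GrpAlg k n × GrpAlg k n)))

/-- The generator `g`. -/
def g : Coef k n :=
  (TrivSqZeroExt.inl (TrivSqZeroExt.inl (grpGen k n)) : DualNumber (DualNumber (GrpAlg k n)))
/-- The generator `a`. -/
def a : Coef k n :=
  (TrivSqZeroExt.inl DualNumber.eps : DualNumber (DualNumber (GrpAlg k n)))
/-- The generator `u`. -/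
def u : Coef k n := (DualNumber.eps : DualNumber (DualNumber (GrpAlg k n)))

variable {k n}

/-- The element with given coefficients of `1`, `a`, `u`, `a u`. -/
def mk (x y z w : GrpAlg k n) : Coef k n :=
  dualMk (dualMk x y) (dualMk z w)

/-- The coefficient of `1`. -/
def c1 (e : Coef k n) : GrpAlg k n := TrivSqZeroExt.fst (TrivSqZeroExt.fst e)
/-- The coefficient of `a`. -/
def ca (e : Coef k n) : GrpAlg k n := TrivSqZeroExt.snd (TrivSqZeroExt.fst e)
/-- The coefficient of `u`. -/
def cu (e : Coef k n) : GrpAlg k n := TrivSqZeroExt.fst (TrivSqZeroExt.snd e)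
/-- The coefficient of `a u`. -/
def cau (e : Coef k n) : GrpAlg k n := TrivSqZeroExt.snd (TrivSqZeroExt.snd e)

/-- The inclusion of the group algebra. -/
def ofGrp : GrpAlg k n →ₐ[k] Coef k n :=
  (TrivSqZeroExt.inlAlgHom k (DualNumber (GrpAlg k n)) (DualNumber (GrpAlg k n))).comp
    (TrivSqZeroExt.inlAlgHom k (GrpAlg k n) (GrpAlg k n))

lemma ofGrp_grpGen : ofGrp (grpGen k n) = g k n := rfl

lemma a_mul_a : a k n * a k n = 0 :=
  (TrivSqZeroExt.inl_mul _ _ _).symm.trans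
    ((congrArg _ DualNumber.eps_mul_eps).trans (TrivSqZeroExt.inl_zero _))

lemma u_mul_u : u k n * u k n = 0 :=
  DualNumber.eps_mul_eps (R := DualNumber (GrpAlg k n))

lemma g_pow : g k n ^ n = 1 := by
  rw [← ofGrp_grpGen, ← map_pow, grpGen_pow_card, map_one]

lemma mk_eq (x y z w : GrpAlg k n) : mk x y z w = ofGrp x + ofGrp y * a k n +
    (ofGrp z + ofGrp w * a k n) * u k n := by
  refine (dualMk_eq_add _ _).trans ?_
  rw [dualMk_eq_add x y, dualMk_eq_add z w, TrivSqZeroExt.inl_add,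
    TrivSqZeroExt.inl_mul, TrivSqZeroExt.inl_add, TrivSqZeroExt.inl_mul]
  rfl

lemma eq_sum (e : Coef k n) : e = ofGrp e.c1 + ofGrp e.ca * a k n +
    (ofGrp e.cu + ofGrp e.cau * a k n) * u k n :=
  mk_eq e.c1 e.ca e.cu e.cau

/-- The algebra map out of `Coef`. -/
def lift {S : Type*} [Ring S] [Algebra k S] (ι : GrpAlg k n →ₐ[k] S) (a u : S) (haa : a * a = 0)
    (huu : u * u = 0) (hua : u * a = a * u) (ha : ∀ c, Commute a (ι c))
    (hu : ∀ c, Commute u (ι c)) : Coef k n →ₐ[k] S :=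
  DualNumber.lift ⟨(DualNumber.lift ⟨(ι, a), haa, ha⟩, u), huu, fun x ↦ by
    rw [DualNumber.lift_apply_apply]
    exact (hu _).add_right ((hu _).mul_right hua)⟩

/-- The coefficient of `g a u`. -/
def trace : Coef k n →ₗ[k] k where
  toFun e := e.cau.coeff (Multiplicative.ofAdd 1)
  map_add' _ _ := rfl
  map_smul' _ _ := rfl

lemma mul_eq_of_sq_zero {A : Type*} [CommRing A] {a u : A} (ha : a * a = 0) (hu : u * u = 0)
    (x y z w : A) :
    (x + y * a + (z + w * a) * u) * (a * u) = x * a * u ∧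
      (y * a + (z + w * a) * u) * u = y * a * u ∧ (z + w * a) * u * a = z * a * u := by
  refine ⟨?_, ?_, ?_⟩
  · linear_combination (y * u) * ha + (z + w * a) * a * hu
  · linear_combination (z + w * a) * hu
  · linear_combination (w * u) * ha

/-- The socle of `E` is `kG · a u`: multiplying by the complementary factor of the first nonzero
coefficient in the order `1, a, u, a u` kills all the later ones. -/
lemma exists_mul_eq {e : Coef k n} (he : e ≠ 0) :
    ∃ e' : Coef k n, ∃ c : GrpAlg k n, c ≠ 0 ∧ e * e' = ofGrp c * a k n * u k n := by
  obtain ⟨x, y, z, w, rfl⟩ : ∃ x y z w : GrpAlg k n,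
    e = ofGrp x + ofGrp y * a k n + (ofGrp z + ofGrp w * a k n) * u k n := ⟨_, _, _, _, eq_sum e⟩
  by_cases hx : x = 0
  · subst hx
    rw [map_zero, zero_add] at he ⊢
    by_cases hy : y = 0
    · subst hy
      rw [map_zero, zero_mul, zero_add] at he ⊢
      by_cases hz : z = 0
      · subst hz
        rw [map_zero, zero_add] at he ⊢
        refine ⟨1, w, ?_, mul_one _⟩
        rintro rfl
        exact he (by rw [map_zero, zero_mul, zero_mul])
      · exact ⟨a k n, z, hz, (mul_eq_of_sq_zero a_mul_a u_mul_u 0 0 (ofGrp z) (ofGrp w)).2.2⟩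
    · exact ⟨u k n, y, hy, (mul_eq_of_sq_zero a_mul_a u_mul_u 0 (ofGrp y) (ofGrp z) (ofGrp w)).2.1⟩
  · refine ⟨a k n * u k n, x, hx, ?_⟩
    exact (mul_eq_of_sq_zero a_mul_a u_mul_u (ofGrp x) (ofGrp y) (ofGrp z) (ofGrp w)).1

lemma trace_ofGrp_mul (c : GrpAlg k n) :
    trace (ofGrp c * a k n * u k n) = c.coeff (Multiplicative.ofAdd 1) := by
  have := mk_eq 0 0 0 c
  rw [map_zero, zero_mul, zero_add, zero_add, zero_add] at this
  rw [← this]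
  rfl

lemma ofGrp_mul_ne_zero {c : GrpAlg k n} (hc : c ≠ 0) : ofGrp c * a k n * u k n ≠ 0 := by
  intro h
  have := mk_eq 0 0 0 c
  rw [map_zero, zero_mul, zero_add, zero_add, zero_add, h] at this
  exact hc (congrArg cau this)

lemma mul_mul_mul_rotate {A : Type*} [CommRing A] (x y a u : A) :
    x * a * u * y = x * y * a * u := by
  ring

/-- `E` is a Frobenius algebra: after reaching the socle, a group element shifts any nonzero
coefficient to the position `g` that `trace` reads. -/
lemma exists_trace_mul_ne_zero {e : Coef k n} (he : e ≠ 0) : ∃ e', trace (e * e') ≠ 0 := by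
  obtain ⟨e', c, hc, h⟩ := exists_mul_eq he
  obtain ⟨m, hm⟩ : ∃ m, c.coeff m ≠ 0 := by
    by_contra! h0
    exact hc (MonoidAlgebra.ext (Finsupp.ext h0))
  refine ⟨e' * ofGrp (MonoidAlgebra.single (m⁻¹ * Multiplicative.ofAdd 1) 1), ?_⟩
  rw [← mul_assoc, h, mul_mul_mul_rotate, ← map_mul ofGrp, trace_ofGrp_mul]
  have := MonoidAlgebra.coeff_mul_single_apply c (1 : k) (m⁻¹ * Multiplicative.ofAdd 1)
    (Multiplicative.ofAdd 1)
  rw [this]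
  simpa using hm

end Coef

end Coefficients

/-! ### Commuting coefficients past `b` -/

section

variable {k : Type*} [Field k] {n : ℕ} {S : Type*} [Ring S] [Algebra k S] {f : Gen → S}

namespace NicholsRel

/-- The embedding of the group algebra given by a family of elements satisfying the relations. -/
def grp (k : Type*) [Field k] [Algebra k S] (h : NicholsRel n f) : GrpAlg k n →ₐ[k] S :=
  grpLift (f .g) (f .gi) h.g_gi h.gi_g h.g_pow

@[simp] lemma grp_grpGen (h : NicholsRel n f) : h.grp k (grpGen k n) = f .g :=
  grpLift_grpGen ..

lemma commute_grp [NeZero n] (h : NicholsRel n f) {x : S} (hx : Commute x (f .g))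
    (c : GrpAlg k n) : Commute x (h.grp k c) := by
  induction c using grpAlg_induction with
  | pow i => simpa using hx.pow_right i
  | add c d hc hd => simpa using hc.add_right hd
  | smul r c hc => simpa using hc.smul_right r

/-- The map from the coefficient ring. -/
def coef (k : Type*) [Field k] [Algebra k S] [NeZero n] (h : NicholsRel n f) :
    Coef k n →ₐ[k] S :=
  Coef.lift (h.grp k) (f .a) (comm f) h.oreRel.a_a h.oreRel.u_u h.oreRel.u_a
    (h.commute_grp h.oreRel.a_g) (h.commute_grp h.oreRel.u_g)

lemma coef_apply [NeZero n] (h : NicholsRel n f) (e : Coef k n) : h.coef k e =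
    h.grp k e.c1 + h.grp k e.ca * f .a +
      (h.grp k e.cu + h.grp k e.cau * f .a) * comm f := rfl

lemma coef_mk [NeZero n] (h : NicholsRel n f) (x y z w : GrpAlg k n) :
    h.coef k (Coef.mk x y z w) =
      h.grp k x + h.grp k y * f .a + (h.grp k z + h.grp k w * f .a) * comm f := rfl

@[simp] lemma coef_ofGrp [NeZero n] (h : NicholsRel n f) (c : GrpAlg k n) :
    h.coef k (Coef.ofGrp c) = h.grp k c := by
  refine (h.coef_mk c 0 0 0).trans ?_
  simp

@[simp] lemma coef_a [NeZero n] (h : NicholsRel n f) : h.coef k (Coef.a k n) = f .a := by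
  refine (h.coef_mk 0 1 0 0).trans ?_
  simp

@[simp] lemma coef_u [NeZero n] (h : NicholsRel n f) : h.coef k (Coef.u k n) = comm f := by
  refine (h.coef_mk 0 0 1 0).trans ?_
  simp

lemma pow_g_mul_b (h : NicholsRel n f) (i : ℕ) :
    f .g ^ i * f .b = f .b * f .g ^ i + (i : k) • (f .a * f .g ^ i) := by
  induction i with
  | zero => simp
  | succ i ih =>
    have hg : f .g * f .b = f .b * f .g + f .a * f .g := by
      rw [h.oreRel.b_g, h.oreRel.a_g, add_assoc, h.add_self, add_zero]
    rw [pow_succ', mul_assoc, ih, mul_add, ← mul_assoc, hg, mul_smul_comm, ← mul_assoc,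
      ← h.oreRel.a_g, Nat.cast_succ, add_smul, one_smul]
    simp only [add_mul, mul_assoc]
    rw [add_assoc, add_comm (f .a * _)]

/-- Here `d` is obtained from `c` by `gⁱ ↦ i gⁱ`, which makes sense because `2 ∣ n` lets `i` mod `n`
determine `i` in `k`. At `g` the factor is 1, which is all that the trace argument needs. -/
lemma exists_grp_mul_b [NeZero n] [CharP k 2] (h2 : 2 ∣ n) (h : NicholsRel n f)
    (c : GrpAlg k n) : ∃ d : GrpAlg k n,
      d.coeff (Multiplicative.ofAdd 1) = c.coeff (Multiplicative.ofAdd 1) ∧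
      h.grp k c * f .b = f .b * h.grp k c + f .a * h.grp k d := by
  induction c using grpAlg_induction with
  | pow i =>
    refine ⟨(i : k) • grpGen k n ^ i, ?_, by simp [h.pow_g_mul_b (k := k)]⟩
    rw [grpGen_pow, MonoidAlgebra.coeff_smul_apply, MonoidAlgebra.coeff_single,
      Finsupp.single_apply]
    split_ifs with hi
    · have hi : (i : ZMod n) = (1 : ℕ) := by simpa using hi
      rw [ZMod.natCast_eq_natCast_iff] at hi
      have : (i : k) = ((1 : ℕ) : k) :=
        (CharP.natCast_eq_natCast k 2).2 (hi.of_dvd h2)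
      simp [this]
    · simp
  | add c c' hc hc' =>
    obtain ⟨d, hd, e⟩ := hc
    obtain ⟨d', hd', e'⟩ := hc'
    refine ⟨d + d', by simp [hd, hd'], ?_⟩
    simp only [map_add, add_mul, mul_add, e, e']
    abel
  | smul r c hc =>
    obtain ⟨d, hd, e⟩ := hc
    exact ⟨r • d, by simp [hd], by simp [e]⟩

lemma exists_coef_mul_b [NeZero n] [CharP k 2] (h2 : 2 ∣ n) (h : NicholsRel n f)
    (e : Coef k n) : ∃ e' : Coef k n, Coef.trace e' = 0 ∧
      h.coef k e * f .b = f .b * h.coef k e + h.coef k e' := by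
  obtain ⟨d00, -, h00⟩ := h.exists_grp_mul_b h2 e.c1
  obtain ⟨d10, -, h10⟩ := h.exists_grp_mul_b h2 e.ca
  obtain ⟨d01, t01, h01⟩ := h.exists_grp_mul_b h2 e.cu
  obtain ⟨d11, -, h11⟩ := h.exists_grp_mul_b h2 e.cau
  -- This is `δ e`. Its `a u` coefficient is `e.cu` plus the derivative of `e.cu`; at `g` the two
  -- agree, so they cancel.
  refine ⟨Coef.mk 0 d00 e.ca (e.cu + d01), ?_, ?_⟩
  · change (e.cu + d01).coeff (Multiplicative.ofAdd 1) = 0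
    rw [MonoidAlgebra.coeff_add, Finsupp.add_apply, t01, CharTwo.add_self_eq_zero]
  · have e1 : h.coef k (Coef.mk 0 d00 e.ca (e.cu + d01) : Coef k n) =
        h.grp k 0 + h.grp k d00 * f .a + (h.grp k e.ca +
          h.grp k (e.cu + d01) * f .a) * comm f := rfl
    have ca (c) : f .a * h.grp k c = h.grp k c * f .a := h.commute_grp h.oreRel.a_g c
    rw [e1, coef_apply, map_zero, zero_add, map_add]
    exact h.oreRel.coef_mul_b (ca _) (ca _) (ca _) (ca _) h00 h10 h01 h11

end NicholsRel
end
/-! ### A matrix model -/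

section Matrices

variable {E : Type*} [CommRing E]

/-- The matrix of multiplication by `e₀` in a differential operator ring in characteristic two,
where `e₁`, `e₂`, `e₃` are the iterated derivatives of `e₀`. -/
def jetMatrix (e₀ e₁ e₂ e₃ : E) : Matrix (Fin 4) (Fin 4) E :=
  !![e₀, e₁, e₂, e₃; 0, e₀, 0, e₂; 0, 0, e₀, e₁; 0, 0, 0, e₀]

/-- The nilpotent shift. -/
def shiftMatrix (E : Type*) [CommRing E] : Matrix (Fin 4) (Fin 4) E :=
  !![0, 0, 0, 0; 1, 0, 0, 0; 0, 1, 0, 0; 0, 0, 1, 0]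

/-- The entries on the right are the Leibniz formulas for a product's derivatives, with binomial
coefficients reduced mod 2. Columns of a jet matrix express `e bʲ` in the right basis `1, b, b²,
b³`. -/
lemma jetMatrix_mul (e₀ e₁ e₂ e₃ f₀ f₁ f₂ f₃ : E) :
    jetMatrix e₀ e₁ e₂ e₃ * jetMatrix f₀ f₁ f₂ f₃ =
      jetMatrix (e₀ * f₀) (e₀ * f₁ + e₁ * f₀) (e₀ * f₂ + e₂ * f₀)
        (e₀ * f₃ + e₁ * f₂ + e₂ * f₁ + e₃ * f₀) := by
  ext i j
  fin_cases i <;> fin_cases j <;> simp [jetMatrix, Matrix.mul_apply, Fin.sum_univ_four]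

lemma jetMatrix_zero : jetMatrix (0 : E) 0 0 0 = 0 := by
  ext i j
  fin_cases i <;> fin_cases j <;> simp [jetMatrix]

lemma jetMatrix_one : jetMatrix (1 : E) 0 0 0 = 1 := by
  ext i j
  fin_cases i <;> fin_cases j <;> simp [jetMatrix]

lemma jetMatrix_pow (e : E) (m : ℕ) : jetMatrix e 0 0 0 ^ m = jetMatrix (e ^ m) 0 0 0 := by
  induction m with
  | zero => simp [jetMatrix_one]
  | succ m ih => simp [pow_succ, ih, jetMatrix_mul]

/-- The matrix form of `b e = e b + δ e`; the last entry is 0 on the right because only three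
derivatives are recorded and the fourth is taken to be 0. -/
lemma shiftMatrix_mul_jetMatrix (h2 : ∀ x : E, x + x = 0) (e₀ e₁ e₂ e₃ : E) :
    shiftMatrix E * jetMatrix e₀ e₁ e₂ e₃ =
      jetMatrix e₀ e₁ e₂ e₃ * shiftMatrix E + jetMatrix e₁ e₂ e₃ 0 := by
  ext i j
  fin_cases i <;> fin_cases j <;>
    simp [jetMatrix, shiftMatrix, Matrix.mul_apply, Fin.sum_univ_four, h2]

lemma jetMatrix_mul_apply_last (e₀ e₁ e₂ e₃ : E) (M : Matrix (Fin 4) (Fin 4) E) (j : Fin 4) :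
    (jetMatrix e₀ e₁ e₂ e₃ * M) 3 j = e₀ * M 3 j := by
  simp [Matrix.mul_apply, Fin.sum_univ_four, jetMatrix]

lemma mul_jetMatrix_apply_zero (e₀ e₁ e₂ e₃ : E) (M : Matrix (Fin 4) (Fin 4) E) (i : Fin 4) :
    (M * jetMatrix e₀ e₁ e₂ e₃) i 0 = M i 0 * e₀ := by
  simp [Matrix.mul_apply, Fin.sum_univ_four, jetMatrix]

lemma shiftMatrix_pow_four :
    shiftMatrix E * (shiftMatrix E * (shiftMatrix E * shiftMatrix E)) = 0 := by
  ext i j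
  fin_cases i <;> fin_cases j <;>
    simp [shiftMatrix, Matrix.mul_apply, Fin.sum_univ_four]

/-- The jets list the successive derivatives `g, ga, gu, 0`, then `a, u, au, 0`, then `u, au, 0, 0`.
-/
lemma jetMatrix_oreRel (h2 : ∀ x : E, x + x = 0) {g a u : E} (haa : a * a = 0) (huu : u * u = 0) :
    OreRel (jetMatrix g (g * a) (g * u) 0) (jetMatrix a u (a * u) 0)
      (jetMatrix u (a * u) 0 0) (shiftMatrix E) := by
  have two : (2 : E) = 0 := by rw [← one_add_one_eq_two, h2]
  constructor
  case add_self =>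
    intro x
    ext i j
    exact h2 _
  case b_b => exact shiftMatrix_pow_four
  case b_g | b_a | b_u =>
    rw [shiftMatrix_mul_jetMatrix h2]
    try rw [jetMatrix_mul]
    try congr 2
    all_goals grind
  all_goals
    simp only [jetMatrix_mul]
    try rw [← jetMatrix_zero]
    congr 1
    all_goals grind

end Matrices

lemma add_self_eq_zero_of_charTwo (k : Type*) [Field k] [CharP k 2] {M : Type*} [AddCommGroup M]
    [Module k M] (x : M) : x + x = 0 := by
  rw [← two_smul k, CharTwo.two_eq_zero, zero_smul]

/-! ### The presented algebra: basis over the coefficients and trace -/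

section Model

variable (k : Type*) [Field k] (n : ℕ)

/-- The generators of the matrix model. -/
def modelGen : Gen → Matrix (Fin 4) (Fin 4) (Coef k n)
  | .g => jetMatrix (Coef.g k n) (Coef.g k n * Coef.a k n) (Coef.g k n * Coef.u k n) 0
  | .gi => jetMatrix (Coef.g k n ^ (n - 1)) (Coef.g k n ^ (n - 1) * Coef.a k n)
      (Coef.g k n ^ (n - 1) * Coef.u k n) 0
  | .a => jetMatrix (Coef.a k n) (Coef.u k n) (Coef.a k n * Coef.u k n) 0
  | .b => shiftMatrix (Coef k n)

variable {k n}

lemma modelGen_rel [NeZero n] [CharP k 2] (hn : 2 ∣ n) : NicholsRel n (modelGen k n) := by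
  have h2 : ∀ x : Coef k n, x + x = 0 := add_self_eq_zero_of_charTwo k
  have two : (2 : Coef k n) = 0 := by rw [← one_add_one_eq_two, h2]
  have hg : Coef.g k n * Coef.g k n ^ (n - 1) = 1 := by
    rw [← pow_succ', Nat.sub_add_cancel (NeZero.one_le), Coef.g_pow]
  have haa := Coef.a_mul_a (k := k) (n := n)
  have huu := Coef.u_mul_u (k := k) (n := n)
  refine NicholsRel.of_oreRel (u := jetMatrix (Coef.u k n) (Coef.a k n * Coef.u k n) 0 0)
    ?_ ?_ ?_ (jetMatrix_oreRel h2 haa huu)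
  · simp only [modelGen, jetMatrix_mul]
    rw [← jetMatrix_one]
    generalize Coef.g k n ^ (n - 1) = gi, Coef.a k n = a, Coef.u k n = u, Coef.g k n = g at *
    congr 1 <;> grind
  · simp only [modelGen, jetMatrix_mul]
    rw [← jetMatrix_one]
    generalize Coef.g k n ^ (n - 1) = gi, Coef.a k n = a, Coef.u k n = u, Coef.g k n = g at *
    congr 1 <;> grind
  · obtain ⟨m, hm⟩ := hn
    have hp := Coef.g_pow (k := k) (n := n)
    -- `δ (g²) = 2 g² a = 0`, so the square of the jet of `g` is scalar. This is how `n` even gives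
    -- `gⁿ = 1` in the model.
    have : modelGen k n .g * modelGen k n .g = jetMatrix (Coef.g k n * Coef.g k n) 0 0 0 := by
      simp only [modelGen, jetMatrix_mul]
      generalize Coef.g k n = g, Coef.a k n = a, Coef.u k n = u at *
      congr 1 <;> grind
    calc modelGen k n .g ^ n = (modelGen k n .g * modelGen k n .g) ^ m := by
          rw [← sq, ← pow_mul, ← hm]
      _ = 1 := by
          rw [this, jetMatrix_pow, ← sq, ← pow_mul, ← hm, hp, jetMatrix_one]

/-- The algebra presented by the relations of `B(V) # kG`. -/
abbrev Pres (k : Type*) [Field k] (n : ℕ) : Type _ := RingQuot (NicholsBos.Rel k n)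

namespace Pres

variable (k n) in
/-- The generators of the presented algebra. -/
def gen (x : Gen) : Pres k n := RingQuot.mkAlgHom k (NicholsBos.Rel k n) (X k x)

lemma mk_rel {x y : FreeAlgebra k Gen} (h : NicholsBos.Rel k n x y) :
    RingQuot.mkAlgHom k (NicholsBos.Rel k n) x = RingQuot.mkAlgHom k (NicholsBos.Rel k n) y :=
  RingQuot.mkAlgHom_rel k h

variable (k n) in
lemma rel [CharP k 2] : NicholsRel n (gen k n) where
  add_self := add_self_eq_zero_of_charTwo k
  g_gi := by simpa [gen] using mk_rel (n := n) (.tensor _ _ (TensorRel.g_gi (k := k)))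
  gi_g := by simpa [gen] using mk_rel (n := n) (.tensor _ _ (TensorRel.gi_g (k := k)))
  g_pow := by simpa [gen] using mk_rel (n := n) (.tensor _ _ (TensorRel.g_pow (k := k)))
  conj_a := by simpa [gen] using mk_rel (n := n) (.tensor _ _ (TensorRel.conj_a (k := k)))
  conj_b := by simpa [gen] using mk_rel (n := n) (.tensor _ _ (TensorRel.conj_b (k := k)))
  a_sq := by simpa [gen] using mk_rel (k := k) (n := n) .a_sq
  b_pow := by simpa [gen] using mk_rel (k := k) (n := n) .b_pow
  baba := by simpa [gen] using mk_rel (k := k) (n := n) .baba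
  bba := by simpa [gen] using mk_rel (k := k) (n := n) .bba

lemma lift_aux {S : Type*} [Ring S] [Algebra k S] {f : Gen → S} (h : NicholsRel n f) :
    ∀ ⦃x y⦄, NicholsBos.Rel k n x y → FreeAlgebra.lift k f x = FreeAlgebra.lift k f y := by
  intro x y hxy
  cases hxy with
  | tensor x y hxy => cases hxy <;> simp [X, h.g_gi, h.gi_g, h.g_pow, h.conj_a, h.conj_b]
  | a_sq => simp [X, h.a_sq]
  | b_pow => simp [X, h.b_pow]
  | baba => simp [X, h.baba]
  | bba => simp [X, h.bba]

/-- The algebra map out of the presented algebra. -/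
def lift {S : Type*} [Ring S] [Algebra k S] {f : Gen → S} (h : NicholsRel n f) :
    Pres k n →ₐ[k] S :=
  RingQuot.liftAlgHom k ⟨FreeAlgebra.lift k f, lift_aux h⟩

@[simp] lemma lift_gen {S : Type*} [Ring S] [Algebra k S] {f : Gen → S} (h : NicholsRel n f)
    (x : Gen) : lift (k := k) h (gen k n x) = f x :=
  (RingQuot.liftAlgHom_mkAlgHom_apply k (FreeAlgebra.lift k f) (lift_aux h) (X k x)).trans
    (FreeAlgebra.lift_ι_apply ..)

lemma algHom_ext {B : Type*} [Semiring B] [Algebra k B] {φ ψ : Pres k n →ₐ[k] B}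
    (h : ∀ x, φ (gen k n x) = ψ (gen k n x)) : φ = ψ := by
  apply RingQuot.ringQuot_ext'
  apply FreeAlgebra.hom_ext
  funext x
  exact h x

lemma induction {P : Pres k n → Prop} (hs : ∀ r : k, P (algebraMap k _ r))
    (hg : ∀ x, P (gen k n x)) (ha : ∀ x y, P x → P y → P (x + y))
    (hm : ∀ x y, P x → P y → P (x * y)) (x : Pres k n) : P x := by
  obtain ⟨y, rfl⟩ := RingQuot.mkAlgHom_surjective k (NicholsBos.Rel k n) x
  induction y using FreeAlgebra.induction with
  | grade0 r => simpa using hs r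
  | grade1 x => exact hg x
  | mul x y hx hy => simpa using hm _ _ hx hy
  | add x y hx hy => simpa using ha _ _ hx hy

variable [NeZero n] [CharP k 2]

/-- The representation of the presented algebra by matrices over the coefficient ring. -/
def rep (hn : 2 ∣ n) : Pres k n →ₐ[k] Matrix (Fin 4) (Fin 4) (Coef k n) :=
  lift (modelGen_rel hn)

variable (k n) in
/-- The embedding of the coefficient ring. -/
def coef : Coef k n →ₐ[k] Pres k n := (rel k n).coef k

/-- The first column of the matrix of `x` is `x` applied to the basis vector `1`, that is, the list
of right `E`-coordinates of `x`. Right multiplication by `E` scales it since jet matrices have first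
column `(e₀, 0, 0, 0)`. -/
lemma rep_mul_coef_apply (hn : 2 ∣ n) (x : Pres k n) (e : Coef k n) (i : Fin 4) :
    rep hn (x * coef k n e) i 0 = rep hn x i 0 * e := by
  have ha : ∀ (x : Pres k n) i,
      rep hn (x * gen k n .a) i 0 = rep hn x i 0 * Coef.a k n := fun x i ↦ by
    simp [rep, modelGen, jetMatrix, Matrix.mul_apply, Fin.sum_univ_four]
  have hg : ∀ (x : Pres k n) i,
      rep hn (x * gen k n .g) i 0 = rep hn x i 0 * Coef.g k n := fun x i ↦ by
    simp [rep, modelGen, jetMatrix, Matrix.mul_apply, Fin.sum_univ_four]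
  have hu : ∀ (x : Pres k n) i,
      rep hn (x * comm (gen k n)) i 0 = rep hn x i 0 * Coef.u k n := fun x i ↦ by
    have h2 : ∀ x : Coef k n, x + x = 0 := add_self_eq_zero_of_charTwo k
    simp [rep, modelGen, jetMatrix, shiftMatrix, comm, Matrix.mul_apply, Fin.sum_univ_four, h2]
  have hc : ∀ (x : Pres k n) (c : GrpAlg k n) i,
      rep hn (x * (rel k n).grp k c) i 0 = rep hn x i 0 * Coef.ofGrp c := fun x c i ↦ by
    induction c using grpAlg_induction with
    | pow j =>
      induction j generalizing x with
      | zero => simp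
      | succ j ih =>
        rw [pow_succ', map_mul ((rel k n).grp k), ← mul_assoc, ih, NicholsRel.grp_grpGen, hg,
          map_mul Coef.ofGrp, mul_assoc,
          Coef.ofGrp_grpGen]
    | add c d hc hd => simp only [map_add, mul_add, Matrix.add_apply, hc, hd]
    | smul r c hc => simp only [map_smul, mul_smul_comm, Matrix.smul_apply, hc]
  conv_rhs => rw [Coef.eq_sum e]
  rw [coef, NicholsRel.coef_apply]
  simp only [mul_add, add_mul, ← mul_assoc, map_add, Matrix.add_apply, ha, hu, hc]

lemma coef_mul_b (hn : 2 ∣ n) (e : Coef k n) : ∃ e' : Coef k n, Coef.trace e' = 0 ∧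
      coef k n e * gen k n .b = gen k n .b * coef k n e + coef k n e' :=
  (rel k n).exists_coef_mul_b hn e

variable (k n) in
/-- The parametrization of the presented algebra by its right basis `1, b, b², b³` over the
coefficient ring. -/
def ofCoords : (Fin 4 → Coef k n) →ₗ[k] Pres k n :=
  ∑ j : Fin 4, LinearMap.mulLeft k (gen k n .b ^ (j : ℕ)) ∘ₗ (coef k n).toLinearMap ∘ₗ
    LinearMap.proj j

lemma ofCoords_apply (e : Fin 4 → Coef k n) :
    ofCoords k n e = coef k n (e 0) + gen k n .b * coef k n (e 1) +
      gen k n .b ^ 2 * coef k n (e 2) + gen k n .b ^ 3 * coef k n (e 3) := by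
  simp [ofCoords, Fin.sum_univ_four]

/-- Coordinates can be recovered from the element, which gives the independence of `1, b, b², b³`
over `E`. -/
lemma rep_ofCoords (hn : 2 ∣ n) (e : Fin 4 → Coef k n) (i : Fin 4) :
    rep hn (ofCoords k n e) i 0 = e i := by
  rw [ofCoords_apply]
  simp only [map_add, Matrix.add_apply, rep_mul_coef_apply]
  rw [← one_mul (coef k n (e 0)), rep_mul_coef_apply]
  fin_cases i <;>
  simp [rep, modelGen, shiftMatrix, pow_succ, Matrix.mul_apply, Fin.sum_univ_four]

lemma exists_ofCoords_mul (hn : 2 ∣ n) (x : Pres k n) (e : Fin 4 → Coef k n) :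
    ∃ e', ofCoords k n e * x = ofCoords k n e' := by
  have hcoef : ∀ (c : Coef k n) (e : Fin 4 → Coef k n),
      ofCoords k n e * coef k n c = ofCoords k n (fun i ↦ e i * c) := by
    intro c e
    simp only [ofCoords_apply, add_mul, map_mul, mul_assoc]
  induction x using induction generalizing e with
  | hs r => exact ⟨r • e, by rw [map_smul, Algebra.algebraMap_eq_smul_one]; simp⟩
  | hg x =>
    cases x with
    | g =>
      refine ⟨fun i ↦ e i * Coef.g k n, ?_⟩
      rw [← hcoef (Coef.g k n), ← Coef.ofGrp_grpGen, coef, NicholsRel.coef_ofGrp,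
        NicholsRel.grp_grpGen]
    | gi =>
      have : gen k n .gi = gen k n .g ^ (n - 1) := by
        calc gen k n .gi = gen k n .gi * gen k n .g ^ n := by rw [(rel k n).g_pow, mul_one]
          _ = gen k n .gi * gen k n .g * gen k n .g ^ (n - 1) := by
            rw [mul_assoc, ← pow_succ', Nat.sub_add_cancel (NeZero.one_le)]
          _ = _ := by rw [(rel k n).gi_g, one_mul]
      refine ⟨fun i ↦ e i * Coef.g k n ^ (n - 1), ?_⟩
      rw [← hcoef (Coef.g k n ^ (n - 1)), ← Coef.ofGrp_grpGen, map_pow, coef,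
        NicholsRel.coef_ofGrp, NicholsRel.grp_grpGen, this]
    | a =>
      refine ⟨fun i ↦ e i * Coef.a k n, ?_⟩
      rw [← hcoef (Coef.a k n), coef, NicholsRel.coef_a]
    | b =>
      obtain ⟨d0, -, h0⟩ := coef_mul_b hn (e 0)
      obtain ⟨d1, -, h1⟩ := coef_mul_b hn (e 1)
      obtain ⟨d2, -, h2⟩ := coef_mul_b hn (e 2)
      obtain ⟨d3, -, h3⟩ := coef_mul_b hn (e 3)
      -- From `bⁱ e b = bⁱ⁺¹ e + bⁱ δ e`; the term with `b⁴` drops out.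
      refine ⟨![d0, e 0 + d1, e 1 + d2, e 2 + d3], ?_⟩
      have b4 (x : Pres k n) :
          gen k n .b * (gen k n .b * (gen k n .b * (gen k n .b * x))) = 0 := by
        simpa only [mul_assoc, zero_mul] using congrArg (· * x) (rel k n).oreRel.b_b
      simp only [ofCoords_apply, add_mul, mul_assoc, h0, h1, h2, h3, mul_add, pow_succ, pow_zero,
        one_mul, b4, map_add, Matrix.cons_val]
      abel
  | ha x y hx hy =>
    obtain ⟨e1, h1⟩ := hx e
    obtain ⟨e2, h2⟩ := hy e
    exact ⟨e1 + e2, by rw [mul_add, h1, h2, map_add]⟩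
  | hm x y hx hy =>
    obtain ⟨e1, h1⟩ := hx e
    obtain ⟨e2, h2⟩ := hy e1
    exact ⟨e2, by rw [← mul_assoc, h1, h2]⟩

lemma ofCoords_surjective (hn : 2 ∣ n) : Function.Surjective (ofCoords k n) := by
  intro x
  obtain ⟨e, he⟩ := exists_ofCoords_mul hn x ![1, 0, 0, 0]
  refine ⟨e, ?_⟩
  rw [← he, ofCoords_apply]
  simp

lemma finite (hn : 2 ∣ n) : Module.Finite k (Pres k n) :=
  Module.Finite.of_surjective (ofCoords k n) (ofCoords_surjective hn)

/-- The coefficient of `b³ a u g`, a symmetrizing form. -/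
def trace (hn : 2 ∣ n) : Pres k n →ₗ[k] k :=
  Coef.trace ∘ₗ (Matrix.entryLinearMap k (Coef k n) 3 0) ∘ₗ (rep hn).toLinearMap

lemma trace_ofCoords (hn : 2 ∣ n) (e : Fin 4 → Coef k n) :
    trace hn (ofCoords k n e) = Coef.trace (e 3) :=
  congrArg Coef.trace (rep_ofCoords hn e 3)

lemma trace_mul_comm (hn : 2 ∣ n) (x y : Pres k n) : trace hn (x * y) = trace hn (y * x) := by
  induction y using induction generalizing x with
  | hs r => rw [Algebra.commutes]
  | hg y =>
    cases y with
    | b =>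
      obtain ⟨e, rfl⟩ := ofCoords_surjective hn x
      obtain ⟨d0, -, h0⟩ := coef_mul_b hn (e 0)
      obtain ⟨d1, -, h1⟩ := coef_mul_b hn (e 1)
      obtain ⟨d2, -, h2⟩ := coef_mul_b hn (e 2)
      obtain ⟨d3, ht, h3⟩ := coef_mul_b hn (e 3)
      -- The commutator with `b` differentiates each coordinate, and the trace of the top derivative
      -- is zero.
      have : ofCoords k n e * gen k n .b = gen k n .b * ofCoords k n e +
          ofCoords k n ![d0, d1, d2, d3] := by
        simp only [ofCoords_apply, add_mul, mul_assoc, h0, h1, h2, h3, mul_add, pow_succ, pow_zero,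
          one_mul, map_add, Matrix.cons_val]
        abel
      rw [this, map_add, trace_ofCoords]
      simp [ht]
    -- The remaining generators are jet matrices, upper triangular with constant diagonal `e₀`, so
    -- the lower left entry of either product is `e₀` times the same entry of the other factor.
    | _ =>
      simp only [trace, rep, modelGen, LinearMap.comp_apply, AlgHom.toLinearMap_apply, map_mul,
        lift_gen, Matrix.entryLinearMap_apply, jetMatrix_mul_apply_last, mul_jetMatrix_apply_zero,
        mul_comm]
  | ha y z hy hz => rw [mul_add, add_mul, map_add, map_add, hy, hz]
  | hm y z hy hz => rw [← mul_assoc, hz, ← mul_assoc, hy, mul_assoc]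

/-- Every nonzero element can be pushed to the top `b³ a u · kG`. Both the nondegeneracy of the form
and the maximality of the relation ideal rest on this. -/
lemma exists_mul_mul_eq (hn : 2 ∣ n) {x : Pres k n} (hx : x ≠ 0) :
    ∃ (i : ℕ) (e : Coef k n) (c : GrpAlg k n), c ≠ 0 ∧ gen k n .b ^ i * x * coef k n e =
      gen k n .b ^ 3 * coef k n (Coef.ofGrp c * Coef.a k n * Coef.u k n) := by
  obtain ⟨e, rfl⟩ := ofCoords_surjective hn x
  have b4 := (rel k n).b_pow
  have b5 : gen k n .b ^ 5 = 0 := by rw [pow_succ, b4, zero_mul]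
  have b6 : gen k n .b ^ 6 = 0 := by rw [pow_succ, b5, zero_mul]
  -- If `e j` is the first nonzero coordinate, left multiplication by `b³⁻ʲ` sends its term to `b³`
  -- and kills the later ones.
  obtain ⟨i, y, hy, h⟩ : ∃ (i : ℕ) (y : Coef k n), y ≠ 0 ∧
      gen k n .b ^ i * ofCoords k n e = gen k n .b ^ 3 * coef k n y := by
    rw [ofCoords_apply]
    by_cases h0 : e 0 = 0
    · by_cases h1 : e 1 = 0
      · by_cases h2 : e 2 = 0
        · refine ⟨0, e 3, fun h3 ↦ hx ?_, ?_⟩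
          · rw [ofCoords_apply]; simp [*]
          · simp [*]
        · refine ⟨1, e 2, h2, ?_⟩
          simp only [h0, h1, map_zero, mul_zero, zero_add, mul_add, ← mul_assoc, ← pow_add]
          simp [b4]
      · refine ⟨2, e 1, h1, ?_⟩
        simp only [h0, map_zero, mul_zero, zero_add, mul_add, ← mul_assoc, ← pow_add, ← pow_succ]
        simp [b4, b5]
    · refine ⟨3, e 0, h0, ?_⟩
      simp only [mul_add, ← mul_assoc, ← pow_add, ← pow_succ]
      simp [b4, b5, b6]
  obtain ⟨e', c, hc, h'⟩ := Coef.exists_mul_eq hy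
  refine ⟨i, e', c, hc, ?_⟩
  rw [h, mul_assoc, ← map_mul, h']

lemma exists_trace_mul_ne_zero (hn : 2 ∣ n) {x : Pres k n} (hx : x ≠ 0) :
    ∃ y, trace hn (x * y) ≠ 0 := by
  obtain ⟨i, e, c, hc, h⟩ := exists_mul_mul_eq hn hx
  have hc' := Coef.ofGrp_mul_ne_zero hc
  obtain ⟨e', he'⟩ := Coef.exists_trace_mul_ne_zero hc'
  -- Symmetry of the trace brings `bⁱ` to the left of `x`, where `exists_mul_mul_eq` applies.
  refine ⟨coef k n e * coef k n e' * gen k n .b ^ i, ?_⟩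
  rw [← mul_assoc, trace_mul_comm, ← mul_assoc, ← mul_assoc, h, mul_assoc, ← map_mul]
  have := trace_ofCoords hn ![0, 0, 0, Coef.ofGrp c * Coef.a k n * Coef.u k n * e']
  rw [ofCoords_apply] at this
  simpa using this.trans_ne he'

end Pres
end Model
/-! ### The kernel of the projection onto the presented algebra -/

namespace TensorBos

variable {k : Type*} [Field k] {n : ℕ}

lemma mem_degGeTwo {u v : Gen} (hu : u ∈ ({.a, .b} : Set Gen)) (hv : v ∈ ({.a, .b} : Set Gen))
    (x y z : TensorBos k n) : x * gen k n u * y * gen k n v * z ∈ degGeTwo k n :=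
  Submodule.subset_span ⟨x, y, z, u, hu, v, hv, rfl⟩

variable (k n) in
/-- `degGeTwo` as an ideal. -/
def degGeTwoIdeal : Ideal (TensorBos k n) where
  carrier := degGeTwo k n
  add_mem' := add_mem
  zero_mem' := zero_mem _
  smul_mem' c x hx := by
    induction hx using Submodule.span_induction with
    | mem x hx =>
      obtain ⟨x, y, z, u, hu, v, hv, rfl⟩ := hx
      have := mem_degGeTwo hu hv (c * x) y z
      rw [smul_eq_mul]
      simpa only [SetLike.mem_coe, mul_assoc] using this
    | zero => simp
    | add x y _ _ hx hy => rw [smul_add]; exact add_mem hx hy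
    | smul r x _ hx =>
      rw [smul_eq_mul, mul_smul_comm]
      exact Submodule.smul_mem _ r hx

instance : (degGeTwoIdeal k n).IsTwoSided where
  mul_mem_of_left {x} c hx := by
    change x ∈ degGeTwo k n at hx
    change x * c ∈ degGeTwo k n
    induction hx using Submodule.span_induction with
    | mem x hx =>
      obtain ⟨x, y, z, u, hu, v, hv, rfl⟩ := hx
      simpa only [mul_assoc] using mem_degGeTwo hu hv x y (z * c)
    | zero => simp
    | add x y _ _ hx hy => rw [add_mul]; exact add_mem hx hy
    | smul r x _ hx =>
      rw [smul_mul_assoc]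
      exact Submodule.smul_mem _ r hx

lemma map_eq_zero_of_mem_degGeTwo {S : Type*} [Ring S] [Algebra k S] (φ : TensorBos k n →ₐ[k] S)
    (ha : φ (gen k n .a) = 0) (hb : φ (gen k n .b) = 0) {x : TensorBos k n}
    (hx : x ∈ degGeTwo k n) : φ x = 0 := by
  have : degGeTwo k n ≤ LinearMap.ker φ.toLinearMap := by
    refine Submodule.span_le.2 ?_
    rintro _ ⟨x, y, z, u, hu, v, hv, rfl⟩
    rcases hu with rfl | rfl <;> simp [ha, hb]
  exact this hx

variable [CharP k 2]

variable (k n) in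
/-- The projection onto the presented algebra. -/
def toPres : TensorBos k n →ₐ[k] Pres k n :=
  lift (Pres.gen k n) (Pres.rel k n).g_gi (Pres.rel k n).gi_g (Pres.rel k n).g_pow
    (Pres.rel k n).conj_a (Pres.rel k n).conj_b

@[simp] lemma toPres_gen (x : Gen) : toPres k n (gen k n x) = Pres.gen k n x := lift_gen ..

lemma toPres_surjective : Function.Surjective (toPres k n) := by
  intro x
  induction x using Pres.induction with
  | hs r => exact ⟨algebraMap k _ r, by simp⟩
  | hg x => exact ⟨_, toPres_gen x⟩
  | ha x y hx hy =>
    obtain ⟨x, rfl⟩ := hx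
    obtain ⟨y, rfl⟩ := hy
    exact ⟨x + y, map_add _ _ _⟩
  | hm x y hx hy =>
    obtain ⟨x, rfl⟩ := hx
    obtain ⟨y, rfl⟩ := hy
    exact ⟨x * y, map_mul _ _ _⟩

/-- Apply `OreRel.tensor` to the two commuting copies of the presented algebra in its tensor square;
`Δ` then descends to the presented algebra. -/
lemma comul_rel : NicholsRel n fun x ↦
    TensorProduct.map (toPres k n).toLinearMap (toPres k n).toLinearMap (comulGen k n x) := by
  have h := Pres.rel k n
  have hs : ∀ x : Pres k n ⊗[k] Pres k n, x + x = 0 := fun x ↦ by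
    rw [← two_smul k, CharTwo.two_eq_zero, zero_smul]
  have hl := (h.map (T := Pres k n ⊗[k] Pres k n) (Algebra.TensorProduct.includeLeft (R := k) (S := k) (A := Pres k n)
    (B := Pres k n)).toRingHom hs).oreRel
  have hr := (h.map (T := Pres k n ⊗[k] Pres k n) (Algebra.TensorProduct.includeRight (R := k) (A := Pres k n)
    (B := Pres k n)).toRingHom hs).oreRel
  have H := hl.tensor hr (by
    have hc : ∀ x y : Pres k n, (Algebra.TensorProduct.includeRight (R := k) (A := Pres k n)
        (B := Pres k n)).toRingHom x * (Algebra.TensorProduct.includeLeft (R := k) (S := k)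
        (A := Pres k n) (B := Pres k n)).toRingHom y = (Algebra.TensorProduct.includeLeft (R := k)
        (S := k) (A := Pres k n) (B := Pres k n)).toRingHom y *
        (Algebra.TensorProduct.includeRight (R := k) (A := Pres k n)
        (B := Pres k n)).toRingHom x := by simp
    simp only [comm, ← map_mul, ← map_add, Set.mem_insert_iff, Set.mem_singleton_iff,
      forall_eq_or_imp, forall_eq, hc, and_self])
  set f : Gen → Pres k n ⊗[k] Pres k n := fun x ↦
    TensorProduct.map (toPres k n).toLinearMap (toPres k n).toLinearMap (comulGen k n x) with hf
  have hg : f .g = Pres.gen k n .g ⊗ₜ Pres.gen k n .g := by simp [hf, comulGen]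
  have hgi : f .gi = Pres.gen k n .gi ⊗ₜ Pres.gen k n .gi := by simp [hf, comulGen]
  have hfa : f .a = Pres.gen k n .a ⊗ₜ 1 + Pres.gen k n .g ⊗ₜ Pres.gen k n .a := by
    simp [hf, comulGen]
  have hfb : f .b = Pres.gen k n .b ⊗ₜ 1 + Pres.gen k n .g ⊗ₜ Pres.gen k n .b := by
    simp [hf, comulGen]
  have key : ∃ w, OreRel (f .g) (f .a) w (f .b) := by
    rw [hg, hfa, hfb]
    simp only [AlgHom.toRingHom_eq_coe, RingHom.coe_coe, Algebra.TensorProduct.includeLeft_apply,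
      Algebra.TensorProduct.includeRight_apply, Algebra.TensorProduct.tmul_mul_tmul, mul_one,
      one_mul] at H
    exact ⟨_, H⟩
  obtain ⟨w, hw⟩ := key
  refine NicholsRel.of_oreRel ?_ ?_ ?_ hw
  · rw [hg, hgi, Algebra.TensorProduct.tmul_mul_tmul, h.g_gi]; rfl
  · rw [hg, hgi, Algebra.TensorProduct.tmul_mul_tmul, h.gi_g]; rfl
  · rw [hg, Algebra.TensorProduct.tmul_pow, h.g_pow]; rfl

lemma antipode_rel : NicholsRel n fun x ↦
    MulOpposite.op (toPres k n (antipodeGen k n x)) := by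
  have h := Pres.rel k n
  have H := h.oreRel.antipode h.g_gi h.gi_g
  have hneg : ∀ x : Pres k n, -x = x := fun x ↦ neg_eq_of_add_eq_zero_left (h.add_self x)
  have hf : (fun x ↦ MulOpposite.op (toPres k n (antipodeGen k n x))) = fun x ↦ match x with
      | .g => MulOpposite.op (Pres.gen k n .gi)
      | .gi => MulOpposite.op (Pres.gen k n .g)
      | .a => MulOpposite.op (Pres.gen k n .gi * Pres.gen k n .a)
      | .b => MulOpposite.op (Pres.gen k n .gi * Pres.gen k n .b) := by
    funext x
    cases x <;> simp only [antipodeGen, toPres_gen, map_neg, map_mul, hneg]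
  rw [hf]
  refine NicholsRel.of_oreRel ?_ ?_ ?_ H
  · simp only [← MulOpposite.op_mul, h.g_gi, MulOpposite.op_one]
  · simp only [← MulOpposite.op_mul, h.gi_g, MulOpposite.op_one]
  · have := congrArg (toPres k n) (gi_pow k n)
    simp only [map_pow, toPres_gen, map_one] at this
    simp only [← MulOpposite.op_pow, this, MulOpposite.op_one]

variable (k n) in
/-- The ideal generated by the relations of the presented algebra. -/
def relIdeal : Ideal (TensorBos k n) := RingHom.ker (toPres k n)

lemma mem_relIdeal {x : TensorBos k n} : x ∈ relIdeal k n ↔ toPres k n x = 0 := Iff.rfl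

instance : (relIdeal k n).IsTwoSided := inferInstanceAs (RingHom.ker (toPres k n)).IsTwoSided

lemma lift_comul_rel (x : TensorBos k n) : Pres.lift (k := k) comul_rel (toPres k n x) =
    TensorProduct.map (toPres k n).toLinearMap (toPres k n).toLinearMap
      (Coalgebra.comul (R := k) x) := by
  have : (Pres.lift (k := k) comul_rel).comp (toPres k n) =
      (Algebra.TensorProduct.map (toPres k n) (toPres k n)).comp (comulHom k n) :=
    algHom_ext fun x ↦ by
      rw [AlgHom.comp_apply, AlgHom.comp_apply, toPres_gen, Pres.lift_gen, comulHom_gen]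
      rfl
  exact DFunLike.congr_fun this x

lemma lift_antipode_rel (x : TensorBos k n) : Pres.lift (k := k) antipode_rel (toPres k n x) =
    MulOpposite.op (toPres k n (HopfAlgebra.antipode k x)) := by
  have : (Pres.lift (k := k) antipode_rel).comp (toPres k n) =
      (AlgHom.op (toPres k n)).comp (antipodeHom k n) :=
    algHom_ext fun x ↦ by
      rw [AlgHom.comp_apply, AlgHom.comp_apply, toPres_gen, Pres.lift_gen, antipodeHom_gen]
      rfl
  exact DFunLike.congr_fun this x

/-- Modulo degree at least two, any product containing two letters from `a, b` is zero. The extra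
relations therefore hold there, and the quotient map factors through `Pres`. -/
lemma relIdeal_le_degGeTwo {x : TensorBos k n} (hx : x ∈ relIdeal k n) : x ∈ degGeTwo k n := by
  let q := Ideal.Quotient.mkₐ k (degGeTwoIdeal k n)
  have hq : ∀ x, x ∈ degGeTwo k n → q x = 0 := fun x hx ↦
    Ideal.Quotient.eq_zero_iff_mem.2 (show x ∈ degGeTwoIdeal k n from hx)
  have h0 : ∀ u ∈ ({.a, .b} : Set Gen), ∀ v ∈ ({.a, .b} : Set Gen),
      ∀ y, q (gen k n u) * y * q (gen k n v) = 0 := by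
    intro u hu v hv y
    obtain ⟨y, rfl⟩ := Ideal.Quotient.mkₐ_surjective k _ y
    rw [← map_mul, ← map_mul]
    exact hq _ (by simpa using mem_degGeTwo hu hv 1 y 1)
  have haa := h0 .a (by simp) .a (by simp)
  have hab := h0 .a (by simp) .b (by simp)
  have hba := h0 .b (by simp) .a (by simp)
  have hbb := h0 .b (by simp) .b (by simp)
  have hrel : NicholsRel n (fun x ↦ q (gen k n x)) := by
    constructor
    · exact add_self_eq_zero_of_charTwo k
    · rw [← map_mul, g_gi, map_one]
    · rw [← map_mul, gi_g, map_one]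
    · rw [← map_pow, g_pow, map_one]
    · rw [← map_mul, ← map_mul, conj_a]
    · rw [← map_mul, ← map_mul, conj_b, map_add]
    · simpa [sq] using haa 1
    · have := hbb 1
      rw [mul_one] at this
      rw [pow_succ, pow_succ, sq, this]; simp
    · have e1 := hba 1
      have e2 := hab 1
      rw [mul_one] at e1 e2
      rw [e1, e2]
      simp
    · have := hbb 1
      rw [mul_one] at this
      rw [sq, this, haa]
      simp
  have : (Pres.lift (k := k) hrel).comp (toPres k n) = q := algHom_ext fun x ↦ by simp
  have h := DFunLike.congr_fun this x
  rw [AlgHom.comp_apply, mem_relIdeal.1 hx, map_zero] at h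
  exact Ideal.Quotient.eq_zero_iff_mem.1 h.symm

lemma relIdeal_mem_hopfIdealsGeTwo : relIdeal k n ∈ hopfIdealsGeTwo k n := by
  refine ⟨inferInstance, ?_, fun _ ↦ relIdeal_le_degGeTwo⟩
  -- A linear section lets the quotient map by `relIdeal` factor through `toPres`, so that `Δ x`
  -- dies once its image in the tensor square of `Pres` does.
  obtain ⟨σ, hσ⟩ := LinearMap.exists_rightInverse_of_surjective (toPres k n).toLinearMap
    (LinearMap.range_eq_top.2 toPres_surjective)
  refine { counit_eq_zero := ?_, map_mkQ_comul_eq_zero := ?_, antipode_mem := ?_ }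
  · intro x hx
    exact map_eq_zero_of_mem_degGeTwo (counitHom k n) (by simp [counitGen]) (by simp [counitGen])
      (relIdeal_le_degGeTwo hx)
  · intro x hx
    have hmk : ((relIdeal k n).restrictScalars k).mkQ =
        (((relIdeal k n).restrictScalars k).mkQ ∘ₗ σ) ∘ₗ (toPres k n).toLinearMap := by
      ext y
      refine (Submodule.Quotient.eq _).2 ?_
      change toPres k n (y - σ (toPres k n y)) = 0
      have := LinearMap.congr_fun hσ (toPres k n y)
      rw [map_sub, sub_eq_zero]
      exact this.symm
    rw [hmk, TensorProduct.map_comp, LinearMap.comp_apply, ← lift_comul_rel]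
    have : toPres k n x = 0 := hx
    rw [this, map_zero, map_zero]
  · intro x hx
    have h := lift_antipode_rel x
    have h0 : toPres k n x = 0 := hx
    rw [h0, map_zero] at h
    exact (MulOpposite.op_injective h).symm

lemma relIdeal_le_nicholsIdeal : relIdeal k n ≤ nicholsIdeal k n :=
  (isGreatest_nicholsIdeal k n).2 relIdeal_mem_hopfIdealsGeTwo

end TensorBos
namespace TensorBos

variable {k : Type*} [Field k] {n : ℕ}

/-! ### Skew derivations -/

variable (k) in
/-- The generators acting on `k ⊕ V`, with `V ⊗ V` divided out. -/
def truncGen : Gen → Matrix (Fin 3) (Fin 3) k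
  | .g => !![1, 0, 0; 0, 1, 1; 0, 0, 1]
  | .gi => !![1, 0, 0; 0, 1, 1; 0, 0, 1]
  | .a => !![0, 0, 0; 1, 0, 0; 0, 0, 0]
  | .b => !![0, 0, 0; 0, 0, 0; 1, 0, 0]

lemma truncGen_g_mul_self [CharP k 2] : truncGen k .g * truncGen k .g = 1 := by
  have : (1 : k) + 1 = 0 := CharTwo.add_self_eq_zero 1
  ext i j
  fin_cases i <;> fin_cases j <;> simp [truncGen, Matrix.mul_apply, Fin.sum_univ_three, this]

/-- The representation of `T(V) # kG` on `k ⊕ V`. -/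
def trunc [CharP k 2] (hn : 2 ∣ n) : TensorBos k n →ₐ[k] Matrix (Fin 3) (Fin 3) k :=
  lift (truncGen k) truncGen_g_mul_self truncGen_g_mul_self
    (by
      obtain ⟨m, rfl⟩ := hn
      rw [pow_mul, sq, truncGen_g_mul_self, one_pow])
    (by
      ext i j
      fin_cases i <;> fin_cases j <;> simp [truncGen, Matrix.mul_apply, Fin.sum_univ_three])
    (by
      ext i j
      fin_cases i <;> fin_cases j <;> simp [truncGen, Matrix.mul_apply, Fin.sum_univ_three])

variable [CharP k 2]

@[simp] lemma trunc_gen (hn : 2 ∣ n) (x : Gen) : trunc hn (gen k n x) = truncGen k x := lift_gen ..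

lemma trunc_zero_apply (hn : 2 ∣ n) (x : TensorBos k n) :
    trunc hn x 0 1 = 0 ∧ trunc hn x 0 2 = 0 := by
  induction x using induction with
  | hs r => simp [Matrix.algebraMap_matrix_apply]
  | hg x => cases x <;> simp [truncGen]
  | ha x y hx hy => simp [hx, hy]
  | hm x y hx hy => simp [Matrix.mul_apply, Fin.sum_univ_three, hx, hy]

lemma trunc_eq_zero (hn : 2 ∣ n) {x : TensorBos k n} (hx : x ∈ degGeTwo k n) :
    trunc hn x = 0 := by
  have key (y : TensorBos k n) {u v : Gen} (hu : u ∈ ({.a, .b} : Set Gen))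
      (hv : v ∈ ({.a, .b} : Set Gen)) : truncGen k u * trunc hn y * truncGen k v = 0 := by
    obtain ⟨h1, h2⟩ := trunc_zero_apply hn y
    rcases hu with rfl | rfl <;> rcases hv with rfl | rfl <;> ext i j <;> fin_cases i <;>
      fin_cases j <;>
      simp [truncGen, Matrix.mul_apply, Matrix.vecMul, dotProduct, Fin.sum_univ_three, h1, h2]
  have : degGeTwo k n ≤ LinearMap.ker (trunc hn).toLinearMap := by
    refine Submodule.span_le.2 ?_
    rintro _ ⟨x, y, z, u, hu, v, hv, rfl⟩
    have := key y hu hv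
    simp only [SetLike.mem_coe, LinearMap.mem_ker, AlgHom.toLinearMap_apply, map_mul, trunc_gen]
    rw [mul_assoc (trunc hn x), mul_assoc (trunc hn x), this, mul_zero, zero_mul]
  exact this hx

/-- The action on `T(V) # kG` of the matrix coefficients of `trunc`, as functionals on the left
tensor factor of the comultiplication. -/
def skew (hn : 2 ∣ n) (i j : Fin 3) : TensorBos k n →ₗ[k] TensorBos k n :=
  (TensorProduct.lid k (TensorBos k n)).toLinearMap ∘ₗ
    (Matrix.entryLinearMap k k i j ∘ₗ (trunc hn).toLinearMap).rTensor _ ∘ₗ Coalgebra.comul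

lemma skew_apply (hn : 2 ∣ n) (i j : Fin 3) (x : TensorBos k n) : skew hn i j x =
    TensorProduct.lid k _ ((Matrix.entryLinearMap k k i j ∘ₗ (trunc hn).toLinearMap).rTensor _
      (comulHom k n x)) := rfl

/-- `Δ` and `trunc` are multiplicative, so the operators compose like matrix entries. In column 0
this is a twisted Leibniz rule: entry `(1, 0)` acts as the derivative along `a`, entry `(2, 0)` as
that along `b`. -/
lemma skew_mul (hn : 2 ∣ n) (i j : Fin 3) (x y : TensorBos k n) :
    skew hn i j (x * y) = ∑ l, skew hn i l x * skew hn l j y := by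
  simp only [skew_apply, map_mul]
  generalize comulHom k n x = z
  generalize comulHom k n y = w
  induction z with
  | zero => simp
  | add z z' hz hz' => simp only [add_mul, map_add, hz, hz', Finset.sum_add_distrib]
  | tmul p q =>
    induction w with
    | zero => simp
    | add w w' hw hw' => simp only [mul_add, map_add, hw, hw', Finset.sum_add_distrib]
    | tmul p' q' => simp [Matrix.mul_apply, Finset.sum_smul, smul_smul, mul_comm]

lemma skew_one (hn : 2 ∣ n) (i j : Fin 3) :
    skew hn i j (1 : TensorBos k n) = (1 : Matrix (Fin 3) (Fin 3) k) i j • 1 := by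
  simp [skew_apply, Algebra.TensorProduct.one_def]

lemma skew_g (hn : 2 ∣ n) (i j : Fin 3) :
    skew hn i j (gen k n .g) = truncGen k .g i j • gen k n .g := by
  simp [skew_apply, comulGen]

lemma skew_a (hn : 2 ∣ n) (i j : Fin 3) :
    skew hn i j (gen k n .a) = truncGen k .a i j • 1 + truncGen k .g i j • gen k n .a := by
  simp [skew_apply, comulGen]

lemma skew_b (hn : 2 ∣ n) (i j : Fin 3) :
    skew hn i j (gen k n .b) = truncGen k .b i j • 1 + truncGen k .g i j • gen k n .b := by
  simp [skew_apply, comulGen]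

lemma skew_g_mul (hn : 2 ∣ n) (x : TensorBos k n) :
    (skew hn · 0 (gen k n .g * x)) = ![gen k n .g * skew hn 0 0 x,
      gen k n .g * skew hn 1 0 x + gen k n .g * skew hn 2 0 x, gen k n .g * skew hn 2 0 x] := by
  funext i
  fin_cases i <;> simp [skew_mul, skew_g, truncGen, Fin.sum_univ_three]

lemma skew_a_mul (hn : 2 ∣ n) (x : TensorBos k n) :
    (skew hn · 0 (gen k n .a * x)) = ![gen k n .a * skew hn 0 0 x,
      skew hn 0 0 x + gen k n .a * skew hn 1 0 x + gen k n .a * skew hn 2 0 x,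
      gen k n .a * skew hn 2 0 x] := by
  funext i
  fin_cases i <;> simp [skew_mul, skew_a, truncGen, Fin.sum_univ_three, add_assoc]

lemma skew_b_mul (hn : 2 ∣ n) (x : TensorBos k n) :
    (skew hn · 0 (gen k n .b * x)) = ![gen k n .b * skew hn 0 0 x,
      gen k n .b * skew hn 1 0 x + gen k n .b * skew hn 2 0 x,
      skew hn 0 0 x + gen k n .b * skew hn 2 0 x] := by
  funext i
  fin_cases i <;> simp [skew_mul, skew_b, truncGen, Fin.sum_univ_three, add_assoc]

/-- The functional vanishes on degrees at least two, hence on the Nichols ideal `I`, so it kills the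
part `I ⊗ T` of `Δ(I) ⊆ I ⊗ T + T ⊗ I` and maps the rest into `I`. -/
lemma skew_mem_nicholsIdeal (hn : 2 ∣ n) (i j : Fin 3) {x : TensorBos k n}
    (hx : x ∈ nicholsIdeal k n) : skew hn i j x ∈ nicholsIdeal k n := by
  let K := (nicholsIdeal k n).restrictScalars k
  let φ : TensorBos k n →ₗ[k] k := Matrix.entryLinearMap k k i j ∘ₗ (trunc hn).toLinearMap
  have hφ : K ≤ LinearMap.ker φ := fun y hy ↦ by
    have := trunc_eq_zero hn ((isGreatest_nicholsIdeal k n).1.2.2 y hy)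
    simp [φ, this]
  have h0 : TensorProduct.map K.mkQ K.mkQ (Coalgebra.comul (R := k) x) = 0 :=
    (inferInstance : (nicholsIdeal k n).IsHopfIdeal k).map_mkQ_comul_eq_zero hx
  have key : ∀ z : TensorBos k n ⊗[k] TensorBos k n,
      K.mkQ (TensorProduct.lid k _ (φ.rTensor _ z)) =
        TensorProduct.lid k _ ((K.liftQ φ hφ).rTensor _ (TensorProduct.map K.mkQ K.mkQ z)) := by
    intro z
    induction z with
    | zero => simp
    | add z w hz hw => simp only [map_add, hz, hw]
    | tmul p q => simp
  have := key (Coalgebra.comul (R := k) x)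
  rw [h0, map_zero, map_zero] at this
  exact (Submodule.Quotient.mk_eq_zero K).1 this

/-! ### The largest Hopf ideal in degrees at least two -/

variable (k n) in
/-- The embedding of the group algebra. -/
def ofGrp : GrpAlg k n →ₐ[k] TensorBos k n :=
  grpLift (gen k n .g) (gen k n .gi) (g_gi k n) (gi_g k n) (g_pow k n)

variable [NeZero n]

lemma skew_ofGrp (hn : 2 ∣ n) (c : GrpAlg k n) :
    (skew hn · 0 (ofGrp k n c)) = ![ofGrp k n c, 0, 0] := by
  induction c using grpAlg_induction with
  | pow i =>
    rw [map_pow, ofGrp, grpLift_grpGen]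
    induction i with
    | zero =>
      funext i
      fin_cases i <;> simp [skew_one]
    | succ i ih =>
      have h0 := congrFun ih 0
      have h1 := congrFun ih 1
      have h2 := congrFun ih 2
      simp only [Matrix.cons_val] at h0 h1 h2
      rw [pow_succ', skew_g_mul, h0, h1, h2]
      simp
  | add c d hc hd =>
    funext i
    have hc := congrFun hc i
    have hd := congrFun hd i
    simp only [map_add, hc, hd]
    fin_cases i <;> simp
  | smul r c hc =>
    funext i
    have hc := congrFun hc i
    simp only [map_smul, hc]
    fin_cases i <;> simp

lemma toPres_ofGrp (c : GrpAlg k n) : toPres k n (ofGrp k n c) = (Pres.rel k n).grp k c := by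
  induction c using grpAlg_induction with
  | pow i => simp [ofGrp]
  | add c d hc hd => simp only [map_add, hc, hd]
  | smul r c hc => simp only [map_smul, hc]

/-- Setting `a = b = 0` retracts `T(V) # kG` onto `kG` and kills degrees at least two. -/
lemma eq_zero_of_ofGrp_mem_degGeTwo {c : GrpAlg k n} (hc : ofGrp k n c ∈ degGeTwo k n) :
    c = 0 := by
  let f : Gen → GrpAlg k n := fun x ↦ match x with
    | .g => grpGen k n
    | .gi => grpGen k n ^ (n - 1)
    | .a => 0
    | .b => 0
  have h1 : f .gi * f .g = 1 := by
    simp only [f]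
    rw [← pow_succ, Nat.sub_add_cancel NeZero.one_le, grpGen_pow_card]
  let φ : TensorBos k n →ₐ[k] GrpAlg k n := lift f (by rw [mul_comm, h1]) h1 grpGen_pow_card
    (by simp [f]) (by simp [f])
  have hφ : φ (ofGrp k n c) = c := by
    clear hc
    induction c using grpAlg_induction with
    | pow i => simp [ofGrp, φ, f]
    | add c d hc hd => simp only [map_add, hc, hd]
    | smul r c hc => simp only [map_smul, hc]
  rw [← hφ]
  exact map_eq_zero_of_mem_degGeTwo φ (lift_gen ..) (lift_gen ..) hc

/-- Write `∂ₐ`, `∂_b` for the skew derivations and `U = uP`. Then `∂ₐ U = aP`, `∂_b U = 0`, and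
`∂ₐ(aU) = U` modulo `a²P`, which lies in the ideal. The powers of `b` need care: `∂_b(b²Q) = 2bQ =
0` when `∂_b Q = 0`, so `∂_b` alone cannot descend from `b²Q`, and `∂ₐ` is used instead. -/
lemma ofGrp_mem_of_top_mem (hn : 2 ∣ n) {P : TensorBos k n}
    (hP : (skew hn · 0 P) = ![P, 0, 0])
    (h : gen k n .b * (gen k n .b * (gen k n .b * (gen k n .a * (comm (gen k n) * P)))) ∈
      nicholsIdeal k n) : P ∈ nicholsIdeal k n := by
  have two : ∀ x : TensorBos k n, x + x = 0 := add_self_eq_zero_of_charTwo k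
  have col : ∀ {x : TensorBos k n} {e : Fin 3 → TensorBos k n}, (skew hn · 0 x) = e →
      skew hn 0 0 x = e 0 ∧ skew hn 1 0 x = e 1 ∧ skew hn 2 0 x = e 2 :=
    fun h ↦ ⟨congrFun h 0, congrFun h 1, congrFun h 2⟩
  have haa : ∀ x : TensorBos k n, gen k n .a * (gen k n .a * x) ∈ nicholsIdeal k n := fun x ↦ by
    refine relIdeal_le_nicholsIdeal (mem_relIdeal.2 ?_)
    simp [mul_mul_of_eq (Pres.rel k n).oreRel.a_a]
  obtain ⟨p0, p1, p2⟩ := col hP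
  simp only [Matrix.cons_val] at p0 p1 p2
  obtain ⟨a0, a1, a2⟩ := col (skew_a_mul hn P)
  obtain ⟨b0, b1, b2⟩ := col (skew_b_mul hn P)
  simp only [Matrix.cons_val, p0, p1, p2, mul_zero, add_zero] at a0 a1 a2 b0 b1 b2
  obtain ⟨ab0, ab1, ab2⟩ := col (skew_a_mul hn (gen k n .b * P))
  obtain ⟨ba0, ba1, ba2⟩ := col (skew_b_mul hn (gen k n .a * P))
  simp only [Matrix.cons_val, a0, a1, a2, b0, b1, b2, mul_zero, add_zero] at ab0 ab1 ab2 ba0 ba1 ba2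
  set U := comm (gen k n) * P with hU
  have hU' : U = gen k n .a * (gen k n .b * P) + gen k n .b * (gen k n .a * P) := by
    rw [hU, comm, add_mul, mul_assoc, mul_assoc]
  have u0 : skew hn 0 0 U = U := by rw [hU', map_add, ab0, ba0]
  have u1 : skew hn 1 0 U = gen k n .a * P := by
    rw [hU', map_add, ab1, ba1, add_right_comm, two, zero_add]
  have u2 : skew hn 2 0 U = 0 := by rw [hU', map_add, ab2, ba2, two]
  obtain ⟨q0, q1, q2⟩ := col (skew_a_mul hn U)
  simp only [Matrix.cons_val, u0, u1, u2, mul_zero, add_zero] at q0 q1 q2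
  -- Two derivatives of `b³Q` when `∂_b Q = 0`, `∂ₐ Q = Q'`: `∂_b(b³Q) = b²Q` and `∂ₐ(b²Q) = b²Q' +
  -- bQ`.
  have step : ∀ Q Q' : TensorBos k n, skew hn 0 0 Q = Q → skew hn 1 0 Q = Q' → skew hn 2 0 Q = 0 →
      gen k n .b * (gen k n .b * (gen k n .b * Q)) ∈ nicholsIdeal k n →
      gen k n .b * (gen k n .b * Q) ∈ nicholsIdeal k n ∧
      gen k n .b * (gen k n .b * Q') + gen k n .b * Q ∈ nicholsIdeal k n := by
    intro Q Q' e0 e1 e2 hQ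
    obtain ⟨r0, r1, r2⟩ := col (skew_b_mul hn Q)
    simp only [Matrix.cons_val, e0, e1, e2, mul_zero, add_zero] at r0 r1 r2
    obtain ⟨s0, s1, s2⟩ := col (skew_b_mul hn (gen k n .b * Q))
    simp only [Matrix.cons_val, r0, r1, r2, two] at s0 s1 s2
    obtain ⟨t0, t1, t2⟩ := col (skew_b_mul hn (gen k n .b * (gen k n .b * Q)))
    simp only [Matrix.cons_val, s0, s1, s2, mul_zero, add_zero] at t0 t1 t2
    have h2 := skew_mem_nicholsIdeal hn 2 0 hQ
    rw [t2] at h2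
    have h1 := skew_mem_nicholsIdeal hn 1 0 h2
    rw [s1] at h1
    exact ⟨h2, h1⟩
  obtain ⟨m1, m2⟩ := step _ _ q0 q1 q2 h
  -- Multiplying `b²U + baU` by `b` and removing `b²aU` leaves `b³U`. A second use of `step` gives
  -- `b²U`, which isolates `baU`; from there single derivatives give in turn `aU`, `U`, `aP` and
  -- `P`.
  have m3 : gen k n .b * (gen k n .b * (gen k n .b * U)) ∈ nicholsIdeal k n := by
    have h3 := (nicholsIdeal k n).mul_mem_left (gen k n .b) m2
    rw [mul_add] at h3
    have h4 := (Ideal.add_mem_iff_left _ m1).1 h3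
    have h5 : gen k n .b * (gen k n .b * (gen k n .b * (gen k n .a * (gen k n .a * P)))) ∈
        nicholsIdeal k n :=
      (nicholsIdeal k n).mul_mem_left _ ((nicholsIdeal k n).mul_mem_left _
        ((nicholsIdeal k n).mul_mem_left _ (haa P)))
    simp only [mul_add] at h4
    exact (Ideal.add_mem_iff_left _ h5).1 h4
  obtain ⟨m4, -⟩ := step _ _ u0 u1 u2 m3
  have m5 : gen k n .b * (gen k n .a * U) ∈ nicholsIdeal k n := by
    have h5 : gen k n .b * (gen k n .b * (gen k n .a * (gen k n .a * P))) ∈ nicholsIdeal k n :=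
      (nicholsIdeal k n).mul_mem_left _ ((nicholsIdeal k n).mul_mem_left _ (haa P))
    simp only [mul_add] at m2
    exact (Ideal.add_mem_iff_right _ (add_mem m4 h5)).1 m2
  have m6 : gen k n .a * U ∈ nicholsIdeal k n := by
    obtain ⟨-, -, r2⟩ := col (skew_b_mul hn (gen k n .a * U))
    simp only [Matrix.cons_val, q0, q2, mul_zero, add_zero] at r2
    simpa only [r2] using skew_mem_nicholsIdeal hn 2 0 m5
  have m7 : U ∈ nicholsIdeal k n := by
    have := skew_mem_nicholsIdeal hn 1 0 m6
    rw [q1] at this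
    exact (Ideal.add_mem_iff_left _ (haa P)).1 this
  have m8 := skew_mem_nicholsIdeal hn 1 0 m7
  rw [u1] at m8
  have m9 := skew_mem_nicholsIdeal hn 1 0 m8
  rwa [a1] at m9

lemma nicholsIdeal_eq_relIdeal (hn : 2 ∣ n) : nicholsIdeal k n = relIdeal k n := by
  refine le_antisymm (fun x hx ↦ ?_) relIdeal_le_nicholsIdeal
  by_contra h0
  obtain ⟨i, e, c, hc, h⟩ := Pres.exists_mul_mul_eq hn h0
  obtain ⟨y, hy⟩ := toPres_surjective (Pres.coef k n e)
  refine hc (eq_zero_of_ofGrp_mem_degGeTwo ((isGreatest_nicholsIdeal k n).1.2.2 _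
    (ofGrp_mem_of_top_mem hn (skew_ofGrp hn c) ?_)))
  have h1 : gen k n .b ^ i * x * y ∈ nicholsIdeal k n :=
    (nicholsIdeal k n).mul_mem_right _ ((nicholsIdeal k n).mul_mem_left _ hx)
  set w := gen k n .b * (gen k n .b * (gen k n .b *
    (gen k n .a * (comm (gen k n) * ofGrp k n c)))) with hw
  -- The two elements agree in `Pres`, and the relation ideal is already known to lie in the Nichols
  -- ideal.
  have h2 : w - gen k n .b ^ i * x * y ∈ nicholsIdeal k n := by
    refine relIdeal_le_nicholsIdeal (mem_relIdeal.2 ?_)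
    have hcomm : comm (Pres.gen k n) * (Pres.rel k n).grp k c =
        (Pres.rel k n).grp k c * comm (Pres.gen k n) :=
      (Pres.rel k n).commute_grp (Pres.rel k n).oreRel.u_g c
    have hcomm' : Pres.gen k n .a * (Pres.rel k n).grp k c =
        (Pres.rel k n).grp k c * Pres.gen k n .a :=
      (Pres.rel k n).commute_grp (Pres.rel k n).oreRel.a_g c
    have e1 : toPres k n (comm (gen k n)) = comm (Pres.gen k n) := by simp [comm]
    rw [map_sub, sub_eq_zero, hw]
    simp only [map_mul, map_pow, toPres_gen, e1, toPres_ofGrp, hy, h]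
    simp only [Pres.coef, map_mul, NicholsRel.coef_ofGrp, NicholsRel.coef_a, NicholsRel.coef_u,
      hcomm, mul_mul_of_eq hcomm', pow_succ, pow_zero, one_mul, mul_assoc]
  simpa using add_mem h2 h1

end TensorBos
/-! ### The integral -/

/-- The element `(∑ gⁱ) a b a b³`. -/
def integral (n : ℕ) {S : Type*} [Ring S] (f : Gen → S) : S :=
  (∑ i ∈ Finset.range n, f .g ^ i) * (f .a * f .b * f .a * f .b ^ 3)

namespace NicholsRel

variable {n : ℕ} {S : Type*} [Ring S] {f : Gen → S}

/-- `aba = a(ab + u) = a u`, which brings the integral into the normal form used below. -/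
lemma aba_mul_b_pow (h : NicholsRel n f) : f .a * f .b * f .a * f .b ^ 3 =
    f .a * (comm f * (f .b * (f .b * f .b))) := by
  have aa := h.oreRel.a_a
  have ba := h.oreRel.b_a
  simp only [pow_succ, pow_zero, one_mul, mul_assoc, mul_mul_of_eq ba, add_mul, mul_add,
    mul_mul_of_eq aa, zero_mul, zero_add]

lemma g_mul_integral (h : NicholsRel n f) : f .g * integral n f = integral n f := by
  have := mul_geom_sum (f .g) n
  rw [h.g_pow, sub_self, sub_mul, one_mul, sub_eq_zero] at this
  rw [integral, ← mul_assoc, this]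

lemma gi_mul_integral (h : NicholsRel n f) : f .gi * integral n f = integral n f := by
  rw [← h.g_mul_integral, ← mul_assoc, h.gi_g, one_mul, h.g_mul_integral]

lemma a_mul_integral (h : NicholsRel n f) : f .a * integral n f = 0 := by
  have : f .a * (∑ i ∈ Finset.range n, f .g ^ i) = (∑ i ∈ Finset.range n, f .g ^ i) * f .a :=
    Commute.sum_right _ _ _ fun i _ ↦ Commute.pow_right h.oreRel.a_g i
  rw [integral, h.aba_mul_b_pow, ← mul_assoc, this, mul_assoc, mul_mul_of_eq h.oreRel.a_a, zero_mul,
    mul_zero]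

/-- Moving `b` to the right past `gⁱ`, `a` and `u` produces extra factors `a` or `u`, killed by `a²
= u² = 0`; what remains contains `b⁴`. -/
lemma b_mul_integral (h : NicholsRel n f) : f .b * integral n f = 0 := by
  have aa := h.oreRel.a_a
  have uu := h.oreRel.u_u
  have ba := h.oreRel.b_a
  have bu := h.oreRel.b_u
  have ha (i : ℕ) : f .a * (f .g ^ i * (f .a * (comm f * (f .b * (f .b * f .b))))) = 0 := by
    rw [← mul_assoc, (Commute.pow_right h.oreRel.a_g i).eq, mul_assoc, mul_mul_of_eq aa, zero_mul,
      mul_zero]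
  have hb (i : ℕ) : f .b * (f .g ^ i * (f .a * (comm f * (f .b * (f .b * f .b))))) = 0 := by
    induction i with
    | zero =>
      rw [pow_zero, one_mul, mul_mul_of_eq ba, add_mul, mul_assoc, mul_mul_of_eq bu,
        mul_mul_of_eq uu, add_mul, mul_add, mul_assoc, mul_assoc, mul_mul_of_eq aa, h.oreRel.b_b]
      simp
    | succ i ih =>
      rw [pow_succ', mul_assoc, mul_mul_of_eq h.oreRel.b_g, add_mul, mul_assoc, mul_assoc, ih, ha]
      simp
  rw [integral, h.aba_mul_b_pow, Finset.sum_mul, Finset.mul_sum]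
  exact Finset.sum_eq_zero fun i _ ↦ hb i

lemma integral_mul_b (h : NicholsRel n f) : integral n f * f .b = 0 := by
  rw [integral, mul_assoc, mul_assoc, ← pow_succ, h.b_pow, mul_zero, mul_zero]

lemma integral_mul_a (h : NicholsRel n f) : integral n f * f .a = 0 := by
  have aa := h.oreRel.a_a
  have uu := h.oreRel.u_u
  have ua := h.oreRel.u_a
  have ba := h.oreRel.b_a
  have bu := h.oreRel.b_u
  rw [integral, h.aba_mul_b_pow]
  simp only [mul_assoc, ba, bu, mul_mul_of_eq ba, mul_mul_of_eq bu, add_mul, mul_add, aa, uu, ua,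
    mul_mul_of_eq aa, mul_mul_of_eq uu, mul_mul_of_eq ua, zero_mul, mul_zero, add_zero]

lemma integral_mul_g (h : NicholsRel n f) : integral n f * f .g = integral n f := by
  have aa := h.oreRel.a_a
  have uu := h.oreRel.u_u
  have ua := h.oreRel.u_a
  have ba := h.oreRel.b_a
  have bu := h.oreRel.b_u
  have ag := h.oreRel.a_g
  have ug := h.oreRel.u_g
  have bg := h.oreRel.b_g
  have hg := h.g_mul_integral
  have key : f .a * (comm f * (f .b * (f .b * f .b))) * f .g =
      f .g * (f .a * (comm f * (f .b * (f .b * f .b)))) := by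
    simp only [mul_assoc, ba, bu, bg, ag, ug, mul_mul_of_eq ba, mul_mul_of_eq bu, add_mul, mul_add,
      mul_mul_of_eq ag, mul_mul_of_eq ug, mul_mul_of_eq bg, aa, uu, ua, mul_mul_of_eq aa,
      mul_mul_of_eq uu, mul_mul_of_eq ua, zero_mul, mul_zero, add_zero]
  rw [integral, h.aba_mul_b_pow] at hg ⊢
  rw [mul_assoc, key, ← mul_assoc, ← hg, ← mul_assoc (f .g)]
  congr 1
  exact (Commute.sum_right _ _ _ fun i _ ↦ (Commute.refl (f .g)).pow_right i).eq.symm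

lemma integral_mul_gi (h : NicholsRel n f) : integral n f * f .gi = integral n f := by
  rw [← h.integral_mul_g, mul_assoc, h.g_gi, mul_one, h.integral_mul_g]

end NicholsRel

lemma Pres.integral_ne_zero {k : Type*} [Field k] [CharP k 2] {n : ℕ} [NeZero n] (hn : 2 ∣ n) :
    integral n (Pres.gen k n) ≠ 0 := by
  intro h
  have h1 : ∀ (i : ℕ) (x : Pres k n),
      rep hn (Pres.gen k n .g ^ i * x) 3 0 = Coef.g k n ^ i * rep hn x 3 0 := by
    intro i x
    induction i with
    | zero => simp
    | succ i ih =>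
      rw [pow_succ', mul_assoc, map_mul, pow_succ', mul_assoc, ← ih]
      simp only [rep, modelGen, lift_gen, jetMatrix_mul_apply_last]
  have h2 : rep hn (Pres.gen k n .a * Pres.gen k n .b * Pres.gen k n .a * Pres.gen k n .b ^ 3) 3 0
      = Coef.a k n * Coef.u k n := by
    simp [rep, modelGen, jetMatrix, shiftMatrix, pow_succ, Matrix.mul_apply, Fin.sum_univ_four]
  have h3 : Coef.ofGrp (∑ i ∈ Finset.range n, grpGen k n ^ i) * Coef.a k n * Coef.u k n = 0 := by
    have := congrArg (fun x ↦ rep hn x 3 0) h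
    simp only [integral, Finset.sum_mul, map_sum, Matrix.sum_apply, h1, h2, map_zero,
      Matrix.zero_apply] at this
    simp only [map_sum, map_pow, Coef.ofGrp_grpGen, Finset.sum_mul, mul_assoc]
    exact this
  refine Coef.ofGrp_mul_ne_zero ?_ h3
  intro h0
  -- In `∑ gⁱ` over `0 ≤ i < n`, only `i = 0` contributes to the coefficient of the identity, which
  -- is therefore 1.
  have := congrArg (fun c ↦ c.coeff 1) h0
  simp only [grpGen_pow, MonoidAlgebra.coeff_sum, Finsupp.finsetSum_apply] at this
  rw [Finset.sum_eq_single 0] at this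
  · simp at this
  · intro i hi hi0
    rw [MonoidAlgebra.coeff_single, Finsupp.single_apply, if_neg]
    intro e
    have e : (i : ZMod n) = 0 := e
    rw [ZMod.natCast_eq_zero_iff] at e
    exact absurd (Nat.le_of_dvd (Nat.pos_of_ne_zero hi0) e) (by simpa using hi)
  · intro h
    exact absurd (Finset.mem_range.2 (NeZero.pos n)) h

/-! ### The Nichols algebra -/

namespace NicholsBos

variable (k : Type*) [Field k] [CharP k 2] (n : ℕ)

lemma rel : NicholsRel n (gen k n) := by
  have hmk : ∀ x y : TensorBos k n, TensorBos.toPres k n x = TensorBos.toPres k n y →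
      Ideal.Quotient.mk (TensorBos.nicholsIdeal k n) x =
        Ideal.Quotient.mk (TensorBos.nicholsIdeal k n) y := fun x y h ↦
    Ideal.Quotient.eq.2 (TensorBos.relIdeal_le_nicholsIdeal
      (TensorBos.mem_relIdeal.2 (by rw [map_sub, h, sub_self])))
  have h := Pres.rel k n
  refine ⟨add_self_eq_zero_of_charTwo k, ?_, ?_, ?_, ?_, ?_, ?_, ?_, ?_, ?_⟩ <;>
    simp only [gen, ← map_mul, ← map_pow, ← map_add] <;>
    first
    | rw [← map_one (Ideal.Quotient.mk (TensorBos.nicholsIdeal k n))]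
    | rw [← map_zero (Ideal.Quotient.mk (TensorBos.nicholsIdeal k n))]
    | skip
  all_goals
    refine hmk _ _ ?_
    simp only [map_mul, map_pow, map_add, map_one, map_zero, TensorBos.toPres_gen, h.g_gi, h.gi_g,
      h.g_pow, h.conj_a, h.conj_b, h.a_sq, h.b_pow, h.baba, h.bba]

variable {k n}

/-- The presentation of the Nichols algebra. -/
def presEquiv [NeZero n] (hn : 2 ∣ n) : Pres k n ≃ₐ[k] NicholsBos k n :=
  AlgEquiv.ofAlgHom (Pres.lift (rel k n))
    (Ideal.Quotient.liftₐ (TensorBos.nicholsIdeal k n) (TensorBos.toPres k n) fun x hx ↦ by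
      rw [TensorBos.nicholsIdeal_eq_relIdeal hn] at hx
      exact hx)
    (Ideal.Quotient.algHom_ext _ (TensorBos.algHom_ext fun x ↦ by
      change Pres.lift (rel k n) (TensorBos.toPres k n (TensorBos.gen k n x)) = gen k n x
      simp))
    (Pres.algHom_ext fun x ↦ by
      rw [AlgHom.comp_apply, Pres.lift_gen]
      exact TensorBos.toPres_gen x)

lemma presEquiv_gen [NeZero n] (hn : 2 ∣ n) (x : Gen) :
    presEquiv hn (Pres.gen k n x) = gen k n x :=
  Pres.lift_gen (rel k n) x

lemma isSymmetricAlgebra [NeZero n] (hn : 2 ∣ n) : IsSymmetricAlgebra k (NicholsBos k n) := by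
  have := Pres.finite (k := k) hn
  refine ⟨Module.Finite.equiv (presEquiv hn).toLinearEquiv, ?_⟩
  let τ : NicholsBos k n →ₗ[k] k := Pres.trace hn ∘ₗ (presEquiv hn).symm.toLinearMap
  have hτ : ∀ x y, τ (x * y) = τ (y * x) := fun x y ↦ by
    simp only [τ, LinearMap.comp_apply, AlgEquiv.toLinearMap_apply, map_mul]
    exact Pres.trace_mul_comm hn _ _
  have hne : ∀ x : NicholsBos k n, x ≠ 0 → ∃ y, τ (x * y) ≠ 0 := fun x hx ↦ by
    obtain ⟨y, hy⟩ := Pres.exists_trace_mul_ne_zero hn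
      (x := (presEquiv hn).symm x) (by simpa using hx)
    refine ⟨presEquiv hn y, ?_⟩
    simpa [τ] using hy
  refine ⟨(LinearMap.mul k (NicholsBos k n)).compr₂ τ, ⟨?_, ?_⟩, ?_, ?_⟩
  · intro x hx
    by_contra h
    obtain ⟨y, hy⟩ := hne x h
    exact hy (hx y)
  · intro x hx
    by_contra h
    obtain ⟨y, hy⟩ := hne x h
    rw [hτ] at hy
    exact hy (hx y)
  · intro x y z
    simp [mul_assoc]
  · intro x y
    simpa using hτ x y

lemma t_ne_zero [NeZero n] (hn : 2 ∣ n) : t k n ≠ 0 := by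
  have : t k n = presEquiv hn (integral n (Pres.gen k n)) := by
    simp only [integral, map_mul, map_sum, map_pow, presEquiv_gen]
    rfl
  rw [this]
  simpa using Pres.integral_ne_zero (k := k) hn

lemma induction {P : NicholsBos k n → Prop} (hs : ∀ r : k, P (algebraMap k _ r))
    (hg : ∀ x, P (gen k n x)) (ha : ∀ x y, P x → P y → P (x + y))
    (hm : ∀ x y, P x → P y → P (x * y)) (x : NicholsBos k n) : P x := by
  obtain ⟨x, rfl⟩ := Ideal.Quotient.mk_surjective x
  induction x using TensorBos.induction with
  | hs r => exact hs r
  | hg x => exact hg x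
  | ha x y hx hy => rw [map_add]; exact ha _ _ hx hy
  | hm x y hx hy => rw [map_mul]; exact hm _ _ hx hy

lemma counit_gen (x : Gen) :
    Coalgebra.counit (R := k) (gen k n x) = TensorBos.counitGen k x :=
  TensorBos.counitHom_gen k n x

lemma isTwoSidedIntegral_t : IsTwoSidedIntegral k (t k n) := by
  have h := rel k n
  have ht : t k n = integral n (gen k n) := rfl
  rw [ht]
  intro x
  induction x using induction with
  | hs r =>
    rw [Algebra.algebraMap_eq_smul_one]
    simp
  | hg x =>
    rw [counit_gen]
    cases x with
    | g => exact ⟨by simpa [TensorBos.counitGen] using h.g_mul_integral,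
        by simpa [TensorBos.counitGen] using h.integral_mul_g⟩
    | gi => exact ⟨by simpa [TensorBos.counitGen] using h.gi_mul_integral,
        by simpa [TensorBos.counitGen] using h.integral_mul_gi⟩
    | a => exact ⟨by simpa [TensorBos.counitGen] using h.a_mul_integral,
        by simpa [TensorBos.counitGen] using h.integral_mul_a⟩
    | b => exact ⟨by simpa [TensorBos.counitGen] using h.b_mul_integral,
        by simpa [TensorBos.counitGen] using h.integral_mul_b⟩
  | ha x y hx hy =>
    rw [add_mul, mul_add, hx.1, hx.2, hy.1, hy.2, map_add, add_smul]
    exact ⟨rfl, rfl⟩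
  | hm x y hx hy =>
    rw [mul_assoc, hy.1, mul_smul_comm, hx.1, ← mul_assoc, hx.2, smul_mul_assoc, hy.2, smul_smul,
      smul_smul, Bialgebra.counit_mul]
    exact ⟨by rw [mul_comm], rfl⟩

lemma antipodeSqInner : AntipodeSqInner k (NicholsBos k n) := by
  have h := rel k n
  -- Both sides are algebra maps, so it suffices to compare generators: `S²(a) = -S(a) S(g⁻¹) = g⁻¹
  -- a g`, and the same for `b`.
  have key : ∀ x : TensorBos k n, TensorBos.antipodeMap k n (TensorBos.antipodeMap k n x) =
      TensorBos.gen k n .gi * x * TensorBos.gen k n .g := by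
    intro x
    induction x using TensorBos.induction with
    | hs r =>
      rw [TensorBos.antipodeMap_algebraMap, TensorBos.antipodeMap_algebraMap,
        ← Algebra.commutes, mul_assoc, TensorBos.gi_g, mul_one]
    | hg x =>
      cases x <;> simp [TensorBos.antipodeGen, TensorBos.antipodeMap_mul, TensorBos.gi_g,
        TensorBos.g_gi, mul_assoc]
    | ha x y hx hy => rw [map_add, map_add, hx, hy, mul_add, add_mul]
    | hm x y hx hy =>
      rw [TensorBos.antipodeMap_mul, TensorBos.antipodeMap_mul, hx, hy]
      simp only [mul_assoc, mul_mul_of_eq (TensorBos.g_gi k n), one_mul]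
  refine ⟨⟨gen k n .gi, gen k n .g, h.gi_g, h.g_gi⟩, fun x ↦ ?_⟩
  obtain ⟨x, rfl⟩ := Ideal.Quotient.mk_surjective x
  exact congrArg (Ideal.Quotient.mk (TensorBos.nicholsIdeal k n)) (key x)

end NicholsBos
end PointedJordan

end

theorem lemma2p1 (k : Type*) [Field k] [IsAlgClosed k] [CharP k 2] (n : ℕ) (hn : 1 < n)
    (h2 : 2 ∣ n) :
    -- `B(V) # kG` is presented by the generators `g`, `g⁻¹`, `a`, `b` and the listed relations
    (∃ e : RingQuot (PointedJordan.NicholsBos.Rel k n) ≃ₐ[k] PointedJordan.NicholsBos k n,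
      ∀ x, e (RingQuot.mkAlgHom k (PointedJordan.NicholsBos.Rel k n) (FreeAlgebra.ι k x)) =
        PointedJordan.NicholsBos.gen k n x) ∧
    -- it is a symmetric algebra
    PointedJordan.IsSymmetricAlgebra k (PointedJordan.NicholsBos k n) ∧
    -- `t` is a nonzero two-sided integral, and the square of the antipode is inner
    PointedJordan.NicholsBos.t k n ≠ 0 ∧
    PointedJordan.IsTwoSidedIntegral k (PointedJordan.NicholsBos.t k n) ∧
    PointedJordan.AntipodeSqInner k (PointedJordan.NicholsBos k n) := by
  have : NeZero n := ⟨by omega⟩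
  exact ⟨⟨PointedJordan.NicholsBos.presEquiv h2, PointedJordan.NicholsBos.presEquiv_gen h2⟩,
    PointedJordan.NicholsBos.isSymmetricAlgebra h2, PointedJordan.NicholsBos.t_ne_zero h2,
    PointedJordan.NicholsBos.isTwoSidedIntegral_t, PointedJordan.NicholsBos.antipodeSqInner⟩
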